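/- Let $c_0=\frac{1}{6\mathrm e}$ and $M_\alpha=\lfloor c_0/\alpha\rfloor+1$ for $\alpha>0$. Let $\mathbb C^d$ carry the maximum norm $|\cdot|$, and for a set $D\subset\mathbb C^d$ and a map $g$ defined on $D$ let $\|g\|_{D}=\sup_{x\in D}|g(x)|$. Let $\varepsilon,\delta>0$ with $\varepsilon/\delta\le c_0$, let $D_0\subset\mathbb C^d$ be any set, and for $r>0$ let $D_r=\{x\in\mathbb C^d:\ |x-y|<r \text{ for some } y\in D_0\}$ be its $r$-neighbourhood. Let $F:D_\delta\to\mathbb C^d$ be analytic with $\|F-\mathrm{id}\|_{D_\delta}\le\varepsilon$. Define finite differences by $\Delta_0(x)=x$, $\Delta_k(x)=\Delta_{k-1}(F(x))-\Delta_{k-1}(x)$ for $k\ge 1$, and, for $m\ge1$, the forward Newton interpolating vector field of order $m$ by $$X_m(x)=\sum_{k=1}^m\frac{(-1)^{k-1}}{k}\,\Delta_k(x),$$ on the set of those $x$ for which $F^k(x)\in D_\delta$ for $0\le k\le m-1$. Let $\Phi^1_{X_m}$ denote the time-one map of the flow of $\dot x=X_m(x)$. 1. $X_1=F-\mathrm{id}$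 is analytic on $D_\delta$ with $\|X_1\|_{D_\delta}\le\varepsilon$, the map $\Phi^1_{X_1}$ is well defined on $D_0$, and $$\|\Phi^1_{X_1}-F\|_{D_0}\le \frac{2\varepsilon^2}{\delta}.$$ 2. For every integer $m$ with $2\le m\le M_{\varepsilon/\delta}$, the field $X_m$ is defined and analytic on $D_{\delta/3}$ with $\|X_m\|_{D_{\delta/3}}\le 2\varepsilon$, the map $\Phi^1_{X_m}$ is well defined on $D_0$, and $$\|\Phi^1_{X_m}-F\|_{D_0}\le 3\varepsilon\left(\frac{6(m-1)\varepsilon}{\delta}\right)^{m}.$$ 3. In particular, for $m=M_{\varepsilon/\delta}$, $$\|\Phi^1_{X_m}-F\|_{D_0}\le 3\varepsilon\,\exp\!\left(-\frac{c_0\,\delta}{\varepsilon}\right).$$ -/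

import Mathlib

open scoped ENNReal

namespace DiscreteAveraging

/-- The supremum norm `‖g‖_D = sup_{x ∈ D} |g x|`, where `|·|` is the maximum norm on `ℂ^d`
(the norm of `Fin d → ℂ`); it takes the value `∞` when `g` is unbounded on `D`. -/
noncomputable def supNorm {d : ℕ} (D : Set (Fin d → ℂ)) (g : (Fin d → ℂ) → (Fin d → ℂ)) : ℝ≥0∞ :=
  ⨆ x ∈ D, ‖g x‖ₑ

/-- `F` belongs to the closed ball of radius `ε` centred at the identity in the space of
analytic maps `D → ℂ^d`. Only the values of `F` on `D` matter. -/
def InBall {d : ℕ} (D : Set (Fin d → ℂ)) (ε : ℝ) (F : (Fin d → ℂ) → (Fin d → ℂ)) : Prop :=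
  AnalyticOnNhd ℂ F D ∧ supNorm D (fun x => F x - x) ≤ ENNReal.ofReal ε

/-- The finite differences along orbits of `F`: `Δ_0 x = x` and
`Δ_k x = Δ_{k-1} (F x) - Δ_{k-1} x` for `k ≥ 1`. -/
def finDiff {d : ℕ} (F : (Fin d → ℂ) → (Fin d → ℂ)) : ℕ → (Fin d → ℂ) → (Fin d → ℂ)
  | 0, x => x
  | k + 1, x => finDiff F k (F x) - finDiff F k x

/-- The forward Newton interpolating vector field of order `m`:
`X_m x = ∑_{k=1}^m ((-1)^(k-1) / k) Δ_k x`. -/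
noncomputable def interpField {d : ℕ} (F : (Fin d → ℂ) → (Fin d → ℂ)) (m : ℕ)
    (x : Fin d → ℂ) : Fin d → ℂ :=
  ∑ k ∈ Finset.Icc 1 m, ((-1 : ℂ) ^ (k - 1) / (k : ℂ)) • finDiff F k x

/-- The points at which the interpolating vector field of order `m` of a map `F : D → ℂ^d` is
defined: the iterates `x, F x, …, F^m x` exist, i.e. `F^k x ∈ D` for `k = 0, …, m - 1`. -/
def interpDomain {d : ℕ} (D : Set (Fin d → ℂ)) (F : (Fin d → ℂ) → (Fin d → ℂ)) (m : ℕ) :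
    Set (Fin d → ℂ) :=
  {x | ∀ k < m, F^[k] x ∈ D}

/-- `γ` solves `γ' = X(γ)`, `γ 0 = x` on the time interval `[0, T]` and stays in the domain `U`
of the vector field `X`. -/
def IsSolution {d : ℕ} (U : Set (Fin d → ℂ)) (X : (Fin d → ℂ) → (Fin d → ℂ)) (T : ℝ)
    (x : Fin d → ℂ) (γ : ℝ → (Fin d → ℂ)) : Prop :=
  γ 0 = x ∧ (∀ t ∈ Set.Icc 0 T, γ t ∈ U) ∧ IsIntegralCurveOn γ (fun _ => X) (Set.Icc 0 T)

/-- `Φ` is, on the set `S`, the time-`T` map of the flow of the vector field `X : U → ℂ^d`: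
for every `x ∈ S` the initial value problem has a solution on `[0, T]`, and every such
solution is at `Φ x` at the time `T`. -/
def IsFlowMap {d : ℕ} (U : Set (Fin d → ℂ)) (X : (Fin d → ℂ) → (Fin d → ℂ)) (T : ℝ)
    (S : Set (Fin d → ℂ)) (Φ : (Fin d → ℂ) → (Fin d → ℂ)) : Prop :=
  ∀ x ∈ S, (∃ γ, IsSolution U X T x γ) ∧ ∀ γ, IsSolution U X T x γ → γ T = Φ x

/-- The constant `c₀ = 1 / (6 e)`. -/
noncomputable def c₀ : ℝ := 1 / (6 * Real.exp 1)

/-- The integer `M_α = ⌊c₀ / α⌋ + 1`. -/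
noncomputable def optOrder (α : ℝ) : ℕ := ⌊c₀ / α⌋₊ + 1

end DiscreteAveraging

/-! Normalise `f = (F - id) / ε`, so that `‖f‖ ≤ 1`, and embed `F` in the family `F_μ = id + μ f`
with complex `μ`. Fix `x₀ ∈ D₀`. On a disk `|μ| < μ₀` the field `X_m` of `F_μ` is bounded by `c |μ|`
near `x₀`, so its time-one map `Φ_μ` is defined at `x₀`, and `Φ_μ(x₀)` is holomorphic in `μ`, as a
locally uniform limit of Euler approximations. The difference `Φ_μ(x₀) - F_μ(x₀)` is at most `(c +
1) μ₀` there and vanishes to order `m + 1` at `μ = 0`, so Schwarz's lemma bounds it by `(c + 1) μ₀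
(|μ| / μ₀) ^ (m + 1)`; the theorem takes `μ = ε`. Constants in the order of vanishing are therefore
irrelevant, and that part can be purely qualitative.

The order of vanishing comes from Newton's polynomial curve `P` through `x₀, F_μ x₀, …, F_μ^m x₀`.
One has `P' 0 = X_m(x₀)`, and at the nodes `0, …, m - 1` the defect `P' - X_m ∘ P` is controlled by
differences of order `m + 1`, which are `O(μ ^ (m + 1))`. The defect is holomorphic and `O(μ)` on a
disk of radius of order `1 / |μ|`, so smallness at `m` nodes spreads to the unit disk
(`exists_norm_le_of_norm_nodes_le`), and Grönwall's inequality compares `P 1 = F_μ x₀` with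
`Φ_μ(x₀)`.

The explicit bound on `X_m` is a second use of Schwarz's lemma in `μ`, applied to each finite
difference; it makes the sum defining `X_m` geometric with ratio `1 / 2`. -/

namespace DiscreteAveraging

open Metric Set Filter Topology
open scoped NNReal

/-! ### Flows of bounded holomorphic fields and their Euler approximations. -/

section General

variable {E : Type*} [NormedAddCommGroup E] [NormedSpace ℂ E]

/-- Cauchy's estimate: a bounded holomorphic map on a ball is Lipschitz on smaller balls. -/
theorem lipschitzOnWith_closedBall_of_norm_le {h : E → E} {x₀ : E} {r R M : ℝ} (hrR : r < R)
    (hd : DifferentiableOn ℂ h (ball x₀ R)) (hM : ∀ x ∈ ball x₀ R, ‖h x‖ ≤ M) :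
    LipschitzOnWith (2 * M / (R - r)).toNNReal h (closedBall x₀ r) := by
  have hsub : ∀ x ∈ closedBall x₀ r, ball x (R - r) ⊆ ball x₀ R := fun x hx =>
    ball_subset_ball' (by rw [mem_closedBall] at hx; linarith)
  refine (convex_closedBall x₀ r).lipschitzOnWith_of_nnnorm_fderiv_le (𝕜 := ℂ)
    (fun x hx => hd.differentiableAt
      (isOpen_ball.mem_nhds (hsub x hx (mem_ball_self (by linarith))))) (fun x hx => ?_)
  rw [← NNReal.coe_le_coe, coe_nnnorm]
  refine le_trans ?_ (Real.le_coe_toNNReal _)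
  refine Complex.norm_fderiv_le_div_of_mapsTo_ball (hd.mono (hsub x hx)) (fun y hy => ?_)
    (by linarith)
  rw [mem_closedBall, dist_eq_norm]
  have h1 := hM y (hsub x hx hy)
  have h2 := hM x (hsub x hx (mem_ball_self (by linarith)))
  linarith [norm_sub_le (h y) (h x)]

/-- Picard–Lindelöf with speed at most `a` on a ball of radius `a`, hence lifespan one. The curve is
taken from the fixed point of the Picard operator because confinement to the ball is needed as well
as existence. -/
theorem exists_integralCurve_Icc [CompleteSpace E] {X : E → E} {x₀ : E} {a : ℝ} {K : ℝ≥0}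
    (ha : 0 ≤ a) (hK : LipschitzOnWith K X (closedBall x₀ a))
    (hX : ∀ x ∈ closedBall x₀ a, ‖X x‖ ≤ a) :
    ∃ γ : ℝ → E, γ 0 = x₀ ∧ (∀ t, γ t ∈ closedBall x₀ a) ∧
      IsIntegralCurveOn γ (fun _ => X) (Icc 0 1) := by
  lift a to ℝ≥0 using ha
  let t₀ : Icc (0 : ℝ) 1 := ⟨0, by simp⟩
  have hf : IsPicardLindelof (fun _ : ℝ => X) t₀ x₀ a 0 a K :=
    IsPicardLindelof.of_time_independent hX hK (by simp [t₀])
  obtain ⟨α, hα⟩ := ODE.FunSpace.exists_isFixedPt_next hf (mem_closedBall_self le_rfl)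
  have h0 : α.compProj (t₀ : ℝ) = x₀ := by
    rw [ODE.FunSpace.compProj_val, ← hα, ODE.FunSpace.next_apply₀]
  refine ⟨α.compProj, h0, fun t => α.compProj_mem_closedBall hf.mul_max_le, fun t ht => ?_⟩
  apply ODE.hasDerivWithinAt_picard_Icc t₀.2 hf.continuousOn_uncurry
    α.continuous_compProj.continuousOn (fun _ _ => α.compProj_mem_closedBall hf.mul_max_le)
    x₀ ht |>.congr_of_mem _ ht
  intro t' ht'
  nth_rw 1 [← hα]
  rw [ODE.FunSpace.compProj_of_mem ht', ODE.FunSpace.next_apply]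

/-- Two integral curves of a locally Lipschitz vector field with the same origin agree. -/
theorem IsIntegralCurveOn.eqOn_Icc_of_locallyLipschitzOn {X : E → E} {U : Set E}
    (hX : LocallyLipschitzOn U X) {γ₁ γ₂ : ℝ → E} {T : ℝ}
    (h₁ : IsIntegralCurveOn γ₁ (fun _ => X) (Icc 0 T))
    (h₂ : IsIntegralCurveOn γ₂ (fun _ => X) (Icc 0 T))
    (hU₁ : ∀ t ∈ Icc 0 T, γ₁ t ∈ U) (hU₂ : ∀ t ∈ Icc 0 T, γ₂ t ∈ U) (h0 : γ₁ 0 = γ₂ 0) :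
    EqOn γ₁ γ₂ (Icc 0 T) := by
  -- The two curves trace a compact subset of `U`, on which local Lipschitz continuity becomes a
  -- single Lipschitz constant.
  have hc : IsCompact (γ₁ '' Icc 0 T ∪ γ₂ '' Icc 0 T) :=
    (isCompact_Icc.image_of_continuousOn h₁.continuousOn).union
      (isCompact_Icc.image_of_continuousOn h₂.continuousOn)
  have hs : γ₁ '' Icc 0 T ∪ γ₂ '' Icc 0 T ⊆ U :=
    union_subset (image_subset_iff.2 hU₁) (image_subset_iff.2 hU₂)
  obtain ⟨K, hK⟩ := (hX.mono hs).exists_lipschitzOnWith_of_compact hc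
  have hder : ∀ {γ : ℝ → E}, IsIntegralCurveOn γ (fun _ => X) (Icc 0 T) →
      ∀ t ∈ Ico 0 T, HasDerivWithinAt γ (X (γ t)) (Ici t) t := fun h t ht =>
    (h t (Ico_subset_Icc_self ht)).mono_of_mem_nhdsWithin
      (mem_of_superset (Icc_mem_nhdsGE ht.2) (Icc_subset_Icc_left ht.1))
  exact ODE_solution_unique_of_mem_Icc_right (fun _ _ => hK) h₁.continuousOn (hder h₁)
    (fun t ht => .inl (mem_image_of_mem _ (Ico_subset_Icc_self ht))) h₂.continuousOn (hder h₂)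
    (fun t ht => .inr (mem_image_of_mem _ (Ico_subset_Icc_self ht))) h0

theorem _root_.AnalyticOnNhd.locallyLipschitzOn {X : E → E} {U : Set E}
    (hX : AnalyticOnNhd ℂ X U) : LocallyLipschitzOn U X := fun x hx => by
  obtain ⟨K, t, ht, hK⟩ := (hX x hx).hasStrictFDerivAt.exists_lipschitzOnWith
  exact ⟨K, t, mem_nhdsWithin_of_mem_nhds ht, hK⟩

/-- The explicit Euler step of size `h` for the vector field `X`. -/
noncomputable def eulerStep (X : E → E) (h : ℝ) (y : E) : E := y + (h : ℂ) • X y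

theorem norm_eulerStep_iterate_sub_le {X : E → E} {x₀ : E} {a h : ℝ} (hh : 0 ≤ h)
    (hX : ∀ x ∈ closedBall x₀ a, ‖X x‖ ≤ a) (k : ℕ) (hk : k * h ≤ 1) (ha : 0 ≤ a) :
    ‖(eulerStep X h)^[k] x₀ - x₀‖ ≤ k * h * a := by
  induction k with
  | zero => simp
  | succ k ih =>
    push_cast at hk ⊢
    have ih := ih (by linarith)
    have hm : (eulerStep X h)^[k] x₀ ∈ closedBall x₀ a := by
      rw [mem_closedBall, dist_eq_norm]
      refine ih.trans ?_
      have : k * h ≤ 1 := by linarith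
      nlinarith
    rw [Function.iterate_succ_apply', eulerStep, add_sub_right_comm]
    refine (norm_add_le _ _).trans ?_
    rw [norm_smul, Complex.norm_real, Real.norm_of_nonneg hh]
    have := mul_le_mul_of_nonneg_left (hX _ hm) hh
    linarith

theorem norm_integralCurve_sub_le {X : E → E} {x₀ : E} {a s t : ℝ} {γ : ℝ → E}
    (hX : ∀ x ∈ closedBall x₀ a, ‖X x‖ ≤ a) (hmem : ∀ t ∈ Icc (0 : ℝ) 1, γ t ∈ closedBall x₀ a)
    (hγ : IsIntegralCurveOn γ (fun _ => X) (Icc 0 1)) (hs : s ∈ Icc (0 : ℝ) 1)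
    (ht : t ∈ Icc (0 : ℝ) 1) : ‖γ t - γ s‖ ≤ a * |t - s| := by
  simpa using (convex_Icc (0 : ℝ) 1).norm_image_sub_le_of_norm_hasDerivWithin_le hγ
    (fun u hu => hX _ (hmem u hu)) hs ht

/-- Local truncation error: `s ↦ γ s - (s - t) X(γ t)` has derivative `X(γ s) - X(γ t)`, of norm at
most `K a h` on the step. -/
theorem norm_integralCurve_sub_eulerStep_le {X : E → E} {x₀ : E} {a t h : ℝ} {K : ℝ≥0}
    {γ : ℝ → E} (hh : 0 ≤ h) (ht : 0 ≤ t) (hth : t + h ≤ 1)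
    (hK : LipschitzOnWith K X (closedBall x₀ a)) (hX : ∀ x ∈ closedBall x₀ a, ‖X x‖ ≤ a)
    (hmem : ∀ t ∈ Icc (0 : ℝ) 1, γ t ∈ closedBall x₀ a)
    (hγ : IsIntegralCurveOn γ (fun _ => X) (Icc 0 1)) (ha : 0 ≤ a) :
    ‖γ (t + h) - eulerStep X h (γ t)‖ ≤ K * a * h ^ 2 := by
  have hsub : Icc t (t + h) ⊆ Icc 0 1 := Icc_subset_Icc ht hth
  have htm : t ∈ Icc t (t + h) := ⟨le_rfl, by linarith⟩
  have key := (convex_Icc t (t + h)).norm_image_sub_le_of_norm_hasDerivWithin_le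
    (f := fun s => γ s - (s - t) • X (γ t)) (f' := fun s => X (γ s) - X (γ t))
    (C := K * (a * h)) (x := t) (y := t + h) (fun s hs => by
      have h1 := (hγ s (hsub hs)).mono hsub
      have h2 : HasDerivWithinAt (fun s : ℝ => (s - t) • X (γ t)) ((1 : ℝ) • X (γ t))
        (Icc t (t + h)) s := ((hasDerivWithinAt_id s _).sub_const t).smul_const _
      rw [one_smul] at h2
      exact h1.sub h2)
    (fun s hs => by
      have h1 := hK.norm_sub_le (hmem s (hsub hs)) (hmem t (hsub htm))
      refine h1.trans (mul_le_mul_of_nonneg_left ?_ K.2)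
      refine (norm_integralCurve_sub_le hX hmem hγ (hsub htm) (hsub hs)).trans ?_
      refine mul_le_mul_of_nonneg_left ?_ ha
      rw [abs_le]; constructor <;> linarith [hs.1, hs.2])
    htm ⟨by linarith, le_rfl⟩
  have e : γ (t + h) - eulerStep X h (γ t)
      = (γ (t + h) - (t + h - t) • X (γ t)) - (γ t - (t - t) • X (γ t)) := by
    rw [eulerStep, add_sub_cancel_left, sub_self, zero_smul, Complex.coe_smul]
    abel
  rw [e]
  refine key.trans_eq ?_
  rw [add_sub_cancel_left, Real.norm_of_nonneg hh]
  ring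

/-- Convergence of the Euler method with an explicit rate. -/
theorem norm_integralCurve_sub_eulerStep_iterate_le {X : E → E} {x₀ : E} {a : ℝ} {K : ℝ≥0}
    {γ : ℝ → E} (ha : 0 ≤ a) (hK : LipschitzOnWith K X (closedBall x₀ a))
    (hX : ∀ x ∈ closedBall x₀ a, ‖X x‖ ≤ a)
    (hmem : ∀ t ∈ Icc (0 : ℝ) 1, γ t ∈ closedBall x₀ a) (h0 : γ 0 = x₀)
    (hγ : IsIntegralCurveOn γ (fun _ => X) (Icc 0 1)) {N : ℕ} (hN : 0 < N) :
    ‖γ 1 - (eulerStep X (1 / N : ℝ))^[N] x₀‖ ≤ K * a * Real.exp K / N := by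
  set h : ℝ := 1 / N with hh
  have hN' : (0 : ℝ) < N := by exact_mod_cast hN
  have hpos : 0 < h := by positivity
  have hNh : N * h = 1 := by rw [hh]; field_simp
  -- Discrete Grönwall: each step adds the truncation error `K a h²` and amplifies the earlier error
  -- by `1 + K h`.
  have main : ∀ k : ℕ, k ≤ N →
      ‖γ (k * h) - (eulerStep X h)^[k] x₀‖ ≤ k * (K * a * h ^ 2) * (1 + K * h) ^ k := by
    intro k
    induction k with
    | zero => simp [h0]
    | succ k ih =>
      intro hk
      have ih := ih (by omega)
      have hk' : ((k : ℝ) + 1) * h ≤ 1 := by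
        refine le_trans (mul_le_mul_of_nonneg_right ?_ hpos.le) hNh.le
        exact_mod_cast hk
      have hkh : (k : ℝ) * h ≤ 1 := by linarith
      have hm1 : γ (k * h) ∈ closedBall x₀ a := hmem _ ⟨by positivity, hkh⟩
      have hm2 : (eulerStep X h)^[k] x₀ ∈ closedBall x₀ a := by
        rw [mem_closedBall, dist_eq_norm]
        refine (norm_eulerStep_iterate_sub_le hpos.le hX k hkh ha).trans ?_
        nlinarith
      have h1 := norm_integralCurve_sub_eulerStep_le (t := k * h) hpos.le (by positivity)
        (by linarith) hK hX hmem hγ ha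
      have h2 : ‖eulerStep X h (γ (k * h)) - eulerStep X h ((eulerStep X h)^[k] x₀)‖
          ≤ (1 + K * h) * ‖γ (k * h) - (eulerStep X h)^[k] x₀‖ := by
        rw [eulerStep, eulerStep, add_sub_add_comm, ← smul_sub]
        refine (norm_add_le _ _).trans ?_
        rw [norm_smul, Complex.norm_real, Real.norm_of_nonneg hpos.le]
        have := mul_le_mul_of_nonneg_left (hK.norm_sub_le hm1 hm2) hpos.le
        linarith
      rw [Function.iterate_succ_apply']
      push_cast
      rw [show ((k : ℝ) + 1) * h = k * h + h by ring]
      have h3 := norm_sub_le_norm_sub_add_norm_sub (γ (k * h + h)) (eulerStep X h (γ (k * h)))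
        (eulerStep X h ((eulerStep X h)^[k] x₀))
      have h4 : (1 : ℝ) ≤ (1 + K * h) ^ (k + 1) := one_le_pow₀ (by
        have : 0 ≤ (K : ℝ) * h := by positivity
        linarith)
      have h5 : (1 + K * h) * ‖γ (k * h) - (eulerStep X h)^[k] x₀‖
          ≤ (1 + K * h) * (k * (K * a * h ^ 2) * (1 + K * h) ^ k) := by gcongr
      have h6 : K * a * h ^ 2 ≤ K * a * h ^ 2 * (1 + K * h) ^ (k + 1) :=
        le_mul_of_one_le_right (by positivity) h4
      calc _ ≤ K * a * h ^ 2 * (1 + K * h) ^ (k + 1)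
              + (1 + K * h) * (k * (K * a * h ^ 2) * (1 + K * h) ^ k) := by linarith
        _ = _ := by ring
  have := main N le_rfl
  rw [hNh] at this
  refine this.trans ?_
  have h7 : (1 + K * h) ^ N ≤ Real.exp K := by
    have h8 : 1 + K * h ≤ Real.exp (K * h) := by linarith [Real.add_one_le_exp (K * h)]
    calc (1 + K * h) ^ N ≤ Real.exp (K * h) ^ N := by gcongr
      _ = Real.exp K := by
        rw [← Real.exp_nat_mul]; congr 1; rw [← mul_assoc, mul_comm (N : ℝ), mul_assoc, hNh, mul_one]
  calc N * (K * a * h ^ 2) * (1 + K * h) ^ N ≤ N * (K * a * h ^ 2) * Real.exp K := by gcongr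
    _ = (N * h) * (K * a * Real.exp K * h) := by ring
    _ = K * a * Real.exp K / N := by rw [hNh, hh]; ring

/-- The time-one map of a holomorphic family of vector fields is holomorphic in the parameter. -/
theorem differentiableOn_integralCurve_one [CompleteSpace E] {X : ℂ × E → E} {x₀ : E}
    {c R μ₀ : ℝ}
    (hc : 0 < c) (hR : c * μ₀ ≤ R) (hd : DifferentiableOn ℂ X (ball 0 μ₀ ×ˢ ball x₀ R))
    (hX : ∀ μ ∈ ball (0 : ℂ) μ₀, ∀ x ∈ ball x₀ R, ‖X (μ, x)‖ ≤ c * ‖μ‖) {γ : ℂ → ℝ → E}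
    (h0 : ∀ μ ∈ ball (0 : ℂ) μ₀, γ μ 0 = x₀)
    (hmem : ∀ μ ∈ ball (0 : ℂ) μ₀, ∀ t ∈ Icc (0 : ℝ) 1, γ μ t ∈ closedBall x₀ (c * ‖μ‖))
    (hγ : ∀ μ ∈ ball (0 : ℂ) μ₀, IsIntegralCurveOn (γ μ) (fun _ x => X (μ, x)) (Icc 0 1)) :
    DifferentiableOn ℂ (fun μ => γ μ 1) (ball 0 μ₀) := by
  have hcl : ∀ μ ∈ ball (0 : ℂ) μ₀, closedBall x₀ (c * ‖μ‖) ⊆ ball x₀ R := fun μ hμ =>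
    closedBall_subset_ball (lt_of_lt_of_le
      (mul_lt_mul_of_pos_left (mem_ball_zero_iff.1 hμ) hc) hR)
  have hXc : ∀ μ ∈ ball (0 : ℂ) μ₀, ∀ x ∈ closedBall x₀ (c * ‖μ‖), ‖X (μ, x)‖ ≤ c * ‖μ‖ :=
    fun μ hμ x hx => hX μ hμ x (hcl μ hμ hx)
  let Y : ℕ → ℕ → ℂ → E := fun N k μ => (eulerStep (fun x => X (μ, x)) (1 / N : ℝ))^[k] x₀
  have hYd : ∀ N : ℕ, 0 < N → ∀ k ≤ N, DifferentiableOn ℂ (Y N k) (ball 0 μ₀) := by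
    intro N hN k
    have hN' : (0 : ℝ) < N := by exact_mod_cast hN
    induction k with
    | zero => intro _; exact differentiableOn_const _
    | succ k ih =>
      intro hk
      have ih := ih (by omega)
      have e : Y N (k + 1) = fun μ => Y N k μ + ((1 / N : ℝ) : ℂ) • X (μ, Y N k μ) := by
        funext μ
        simp only [Y, Function.iterate_succ_apply']
        rfl
      rw [e]
      refine ih.add ((hd.comp (differentiableOn_id.prodMk ih) fun μ hμ => ?_).const_smul _)
      refine ⟨hμ, hcl μ hμ ?_⟩
      have hk1 : (k : ℝ) * (1 / N) ≤ 1 := by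
        rw [mul_one_div, div_le_one hN']; exact_mod_cast (by omega : k ≤ N)
      rw [mem_closedBall, dist_eq_norm]
      refine (norm_eulerStep_iterate_sub_le (a := c * ‖μ‖) (by positivity) (hXc μ hμ) k hk1
        (by positivity)).trans ?_
      exact mul_le_of_le_one_left (by positivity) hk1
  have hlim : TendstoLocallyUniformlyOn (fun N => Y N N) (fun μ => γ μ 1) atTop (ball 0 μ₀) := by
    rw [tendstoLocallyUniformlyOn_iff_forall_isCompact isOpen_ball]
    intro S hS hSc
    -- Staying in a smaller closed disk leaves the margin `R - c r > 0`, so Cauchy's estimate gives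
    -- one Lipschitz constant, and one Euler rate, for all `μ ∈ S`.
    obtain ⟨r, hr, hSr⟩ : ∃ r, r < μ₀ ∧ S ⊆ closedBall 0 r := by
      rcases S.eq_empty_or_nonempty with rfl | hne
      · exact ⟨μ₀ - 1, by linarith, empty_subset _⟩
      · obtain ⟨z, hz, hmax⟩ := hSc.exists_isMaxOn hne continuous_norm.continuousOn
        exact ⟨‖z‖, mem_ball_zero_iff.1 (hS hz), fun w hw => mem_closedBall_zero_iff.2 (hmax hw)⟩
    have hcr : c * r < R := lt_of_lt_of_le (mul_lt_mul_of_pos_left hr hc) hR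
    set K : ℝ≥0 := (2 * (c * μ₀) / (R - c * r)).toNNReal with hKdef
    have hKl : ∀ μ ∈ S, LipschitzOnWith K (fun x => X (μ, x)) (closedBall x₀ (c * r)) := by
      intro μ hμ
      refine lipschitzOnWith_closedBall_of_norm_le hcr ?_ ?_
      · exact hd.comp ((differentiableOn_const μ).prodMk differentiableOn_id)
          fun x hx => ⟨hS hμ, hx⟩
      · intro x hx
        refine (hX μ (hS hμ) x hx).trans ?_
        have := mem_ball_zero_iff.1 (hS hμ)
        gcongr
    have hbd : ∀ N : ℕ, 0 < N → ∀ μ ∈ S, ‖γ μ 1 - Y N N μ‖ ≤ K * (c * r) * Real.exp K / N := by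
      intro N hN μ hμ
      have hμr : ‖μ‖ ≤ r := mem_closedBall_zero_iff.1 (hSr hμ)
      have hsub : closedBall x₀ (c * ‖μ‖) ⊆ closedBall x₀ (c * r) :=
        closedBall_subset_closedBall (by gcongr)
      refine (norm_integralCurve_sub_eulerStep_iterate_le (a := c * ‖μ‖) (by positivity)
        ((hKl μ hμ).mono hsub) (hXc μ (hS hμ)) (hmem μ (hS hμ)) (h0 μ (hS hμ)) (hγ μ (hS hμ))
        hN).trans ?_
      gcongr
    rw [Metric.tendstoUniformlyOn_iff]
    intro e he
    have ht : Tendsto (fun N : ℕ => K * (c * r) * Real.exp K / (N : ℝ)) atTop (𝓝 0) :=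
      tendsto_const_div_atTop_nhds_zero_nat _
    filter_upwards [ht.eventually (gt_mem_nhds he), eventually_gt_atTop 0] with N hN hN0 μ hμ
    rw [dist_eq_norm]
    exact (hbd N hN0 μ hμ).trans_lt hN
  exact hlim.differentiableOn
    ((eventually_gt_atTop 0).mono fun N hN => hYd N hN N le_rfl) isOpen_ball

/-! ### Propagation of smallness from integer nodes to the unit disk. -/

/-- A holomorphic function which is bounded on a large disk of radius `R` and small at the nodes
`0, …, n - 1` is small on the unit disk, up to an error of order `R ^ (-n)`. -/
theorem exists_norm_le_of_norm_nodes_le [CompleteSpace E] (n : ℕ) : ∃ C : ℝ, 0 ≤ C ∧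
    ∀ (R M η : ℝ) (g : ℂ → E), 2 * n + 2 ≤ R → DifferentiableOn ℂ g (ball 0 R) →
      (∀ t ∈ ball (0 : ℂ) R, ‖g t‖ ≤ M) → (∀ i < n, ‖g (i : ℂ)‖ ≤ η) → 0 ≤ η →
      ∀ t : ℂ, ‖t‖ ≤ 1 → ‖g t‖ ≤ C * (η + M / R ^ n) := by
  induction n with
  | zero =>
    refine ⟨1, zero_le_one, fun R M η g hR _ hM _ hη t ht => ?_⟩
    have := hM t (mem_ball_zero_iff.2 (by norm_num at hR; linarith))
    simp; linarith
  | succ n ih =>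
    obtain ⟨C, hC, ih⟩ := ih
    refine ⟨1 + (n + 1) * (C * 4), by positivity, fun R M η g hR hd hM hη hη0 t ht => ?_⟩
    push_cast at hR
    have hn0 : (0 : ℝ) ≤ n := n.cast_nonneg
    have hR0 : 0 < R := by linarith
    have hnR : (n : ℂ) ∈ ball (0 : ℂ) R := by
      rw [mem_ball_zero_iff, Complex.norm_natCast]; linarith
    have hM0 : 0 ≤ M := (norm_nonneg _).trans (hM _ hnR)
    have hsub : ball (n : ℂ) (R / 2) ⊆ ball 0 R := ball_subset_ball' (by
      rw [dist_zero_right, Complex.norm_natCast]; linarith)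
    -- Dividing out the node `n` gains a factor `1 / R` in the global bound: Schwarz's lemma near
    -- the node, the trivial quotient away from it. The values at the other nodes deteriorate only
    -- by a constant, since nodes are at distance at least one.
    have hbound : ∀ s ∈ ball (0 : ℂ) R, ‖dslope g n s‖ ≤ 4 * M / R := by
      intro s hs
      by_cases hsn : s ∈ ball (n : ℂ) (R / 2)
      · refine (Complex.norm_dslope_le_div_of_mapsTo_ball (R₂ := 2 * M) (hd.mono hsub)
          (fun w hw => ?_) hsn).trans_eq (by field_simp; ring)
        rw [mem_closedBall, dist_eq_norm]
        linarith [norm_sub_le (g w) (g n), hM w (hsub hw), hM _ hnR]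
      · have hdist : R / 2 ≤ ‖s - n‖ := by
          rw [mem_ball, dist_eq_norm] at hsn; linarith
        have hne : s ≠ n := fun h => by rw [h, sub_self, norm_zero] at hdist; linarith
        rw [dslope_of_ne _ hne, slope_def_module, norm_smul, norm_inv, ← div_eq_inv_mul]
        calc ‖g s - g n‖ / ‖s - n‖ ≤ (2 * M) / (R / 2) := by
              gcongr
              linarith [norm_sub_le (g s) (g n), hM s hs, hM _ hnR]
          _ = 4 * M / R := by field_simp; ring
    have hnodes : ∀ i < n, ‖dslope g n (i : ℂ)‖ ≤ 4 * η := by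
      intro i hi
      have hne : (i : ℂ) ≠ n := by exact_mod_cast hi.ne
      have h1 : (1 : ℝ) ≤ ‖(i : ℂ) - n‖ := by
        have : ((i : ℂ) - n) = (((i : ℤ) - (n : ℤ) : ℤ) : ℂ) := by push_cast; ring
        rw [this, Complex.norm_intCast]
        exact_mod_cast Int.one_le_abs (z := (i : ℤ) - n) (by omega)
      rw [dslope_of_ne _ hne, slope_def_module, norm_smul, norm_inv, ← div_eq_inv_mul]
      refine (div_le_self (norm_nonneg _) h1).trans ?_
      linarith [norm_sub_le (g i) (g n), hη i (by omega), hη n (by omega)]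
    have key := ih R (4 * M / R) (4 * η) (dslope g n) (by linarith)
      ((Complex.differentiableOn_dslope (isOpen_ball.mem_nhds hnR)).2 hd) hbound hnodes
      (by linarith) t ht
    have e : g t = g n + (t - n) • dslope g n t := by
      rw [sub_smul_dslope]; abel
    have htn : ‖t - n‖ ≤ n + 1 := by
      refine (norm_sub_le _ _).trans ?_
      rw [Complex.norm_natCast]; linarith
    rw [e]
    refine (norm_add_le _ _).trans ?_
    rw [norm_smul]
    calc ‖g n‖ + ‖t - n‖ * ‖dslope g n t‖
        ≤ η + (n + 1) * (C * (4 * η + 4 * M / R / R ^ n)) := by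
          gcongr
          exact hη n (by omega)
      _ = η + (n + 1) * (C * 4) * (η + M / R ^ (n + 1)) := by
          rw [pow_succ]; field_simp
      _ ≤ (1 + (n + 1) * (C * 4)) * (η + M / R ^ (n + 1)) := by
          have : 0 ≤ M / R ^ (n + 1) := by positivity
          nlinarith

end General

/-! ### Newton interpolation along an orbit. -/

/-- The binomial polynomials `t ↦ t (t - 1) ⋯ (t - k + 1) / k!`. -/
noncomputable def newtonBasis : ℕ → Polynomial ℂ
  | 0 => 1
  | k + 1 => Polynomial.C (1 / ((k : ℂ) + 1)) * newtonBasis k *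
      (Polynomial.X - Polynomial.C (k : ℂ))

theorem eval_newtonBasis_zero (t : ℂ) : (newtonBasis 0).eval t = 1 := by simp [newtonBasis]

theorem eval_newtonBasis_succ (k : ℕ) (t : ℂ) :
    (newtonBasis (k + 1)).eval t = 1 / ((k : ℂ) + 1) * (newtonBasis k).eval t * (t - k) := by
  simp [newtonBasis]

theorem eval_newtonBasis_succ_add_one (k : ℕ) (t : ℂ) :
    (newtonBasis (k + 1)).eval (t + 1)
      = (newtonBasis (k + 1)).eval t + (newtonBasis k).eval t := by
  induction k with
  | zero => simp [newtonBasis]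
  | succ k ih =>
    have h1 : (k : ℂ) + 1 ≠ 0 := Nat.cast_add_one_ne_zero k
    have h2 : (k : ℂ) + 1 + 1 ≠ 0 := by exact_mod_cast Nat.cast_add_one_ne_zero (R := ℂ) (k + 1)
    rw [eval_newtonBasis_succ (k + 1) (t + 1), ih, eval_newtonBasis_succ (k + 1) t,
      eval_newtonBasis_succ k t]
    push_cast
    field_simp
    ring

theorem eval_derivative_newtonBasis_succ_add_one (k : ℕ) (t : ℂ) :
    (newtonBasis (k + 1)).derivative.eval (t + 1)
      = (newtonBasis (k + 1)).derivative.eval t + (newtonBasis k).derivative.eval t := by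
  have h : (newtonBasis (k + 1)).comp (Polynomial.X + 1) = newtonBasis (k + 1) + newtonBasis k :=
    Polynomial.funext fun s => by simp [eval_newtonBasis_succ_add_one]
  have := congrArg (fun p => p.derivative.eval t) h
  simpa [Polynomial.derivative_comp] using this

theorem eval_newtonBasis_natCast {k i : ℕ} (hik : i < k) : (newtonBasis k).eval (i : ℂ) = 0 := by
  induction k with
  | zero => omega
  | succ k ih =>
    rw [eval_newtonBasis_succ]
    rcases Nat.lt_succ_iff_lt_or_eq.1 hik with h | rfl
    · simp [ih h]
    · simp

/-- These values are the coefficients of `X_m`, which is why `X_m` is the initial velocity of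
Newton's curve. -/
theorem eval_derivative_newtonBasis_succ_zero (k : ℕ) :
    (newtonBasis (k + 1)).derivative.eval 0 = (-1) ^ k / ((k : ℂ) + 1) := by
  induction k with
  | zero => simp [newtonBasis]
  | succ k ih =>
    have h1 : (k : ℂ) + 1 ≠ 0 := Nat.cast_add_one_ne_zero k
    have h2 : (k : ℂ) + 1 + 1 ≠ 0 := by exact_mod_cast Nat.cast_add_one_ne_zero (R := ℂ) (k + 1)
    have h0 : (newtonBasis (k + 1)).eval (0 : ℂ) = 0 := by
      simpa using eval_newtonBasis_natCast (Nat.succ_pos k)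
    have e : newtonBasis (k + 1 + 1) = Polynomial.C (1 / (((k + 1 : ℕ) : ℂ) + 1)) *
        newtonBasis (k + 1) * (Polynomial.X - Polynomial.C ((k + 1 : ℕ) : ℂ)) := rfl
    rw [e]
    simp only [Polynomial.derivative_mul, Polynomial.derivative_C, Polynomial.derivative_sub,
      Polynomial.derivative_X, Polynomial.eval_add, Polynomial.eval_mul, Polynomial.eval_sub,
      Polynomial.eval_C, Polynomial.eval_X, Polynomial.eval_zero, Polynomial.eval_one, ih, h0]
    push_cast
    field_simp
    ring

theorem norm_eval_newtonBasis_le (k : ℕ) (t : ℂ) :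
    ‖(newtonBasis k).eval t‖ ≤ (‖t‖ + k) ^ k := by
  induction k with
  | zero => simp [newtonBasis]
  | succ k ih =>
    rw [eval_newtonBasis_succ, norm_mul, norm_mul, pow_succ]
    have h1 : ‖1 / ((k : ℂ) + 1)‖ ≤ 1 := by
      rw [norm_div, norm_one, ← Nat.cast_add_one, Complex.norm_natCast]
      exact (div_le_one (by positivity)).2 (by exact_mod_cast Nat.succ_pos k)
    have h2 : ‖t - k‖ ≤ ‖t‖ + (k + 1 : ℕ) := by
      refine (norm_sub_le _ _).trans ?_
      rw [Complex.norm_natCast]; push_cast; linarith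
    have h3 : (‖t‖ + k) ^ k ≤ (‖t‖ + (k + 1 : ℕ)) ^ k := by gcongr; omega
    calc _ ≤ 1 * (‖t‖ + k) ^ k * (‖t‖ + (k + 1 : ℕ)) := by gcongr
      _ ≤ _ := by rw [one_mul]; gcongr

variable {d : ℕ}

/-- Since `Δ_k (F x) = Δ_k x + Δ_{k+1} x`, Pascal's rule absorbs every term but the last. The
coefficients are abstract so that the identity serves both the curve and its velocity. -/
theorem sum_smul_finDiff_map (F : (Fin d → ℂ) → (Fin d → ℂ)) (b b' : ℕ → ℂ) (h0 : b' 0 = b 0)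
    (hs : ∀ k, b' (k + 1) = b (k + 1) + b k) (m : ℕ) (x : Fin d → ℂ) :
    ∑ k ∈ Finset.range (m + 1), b k • finDiff F k (F x)
      = ∑ k ∈ Finset.range (m + 1), b' k • finDiff F k x + b m • finDiff F (m + 1) x := by
  induction m with
  | zero =>
    simp only [zero_add, Finset.sum_range_one, h0, finDiff]
    module
  | succ m ih =>
    rw [Finset.sum_range_succ, ih, Finset.sum_range_succ _ (m + 1), hs m]
    have : finDiff F (m + 1 + 1) x = finDiff F (m + 1) (F x) - finDiff F (m + 1) x := rfl
    rw [this]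
    module

/-- Newton's interpolating curve through the points `x, F x, …, F^m x`. -/
noncomputable def newtonCurve (F : (Fin d → ℂ) → (Fin d → ℂ)) (m : ℕ) (x : Fin d → ℂ)
    (t : ℂ) : Fin d → ℂ :=
  ∑ k ∈ Finset.range (m + 1), (newtonBasis k).eval t • finDiff F k x

/-- The derivative of `newtonCurve`. -/
noncomputable def newtonVelocity (F : (Fin d → ℂ) → (Fin d → ℂ)) (m : ℕ) (x : Fin d → ℂ)
    (t : ℂ) : Fin d → ℂ :=
  ∑ k ∈ Finset.range (m + 1), (newtonBasis k).derivative.eval t • finDiff F k x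

theorem hasDerivAt_newtonCurve (F : (Fin d → ℂ) → (Fin d → ℂ)) (m : ℕ) (x : Fin d → ℂ) (t : ℂ) :
    HasDerivAt (newtonCurve F m x) (newtonVelocity F m x t) t := by
  have := HasDerivAt.fun_sum (u := Finset.range (m + 1)) (x := t)
    (A := fun k s => (newtonBasis k).eval s • finDiff F k x)
    (A' := fun k => (newtonBasis k).derivative.eval t • finDiff F k x)
    fun k _ => ((newtonBasis k).hasDerivAt t).smul_const _
  exact this

theorem newtonCurve_add_one (F : (Fin d → ℂ) → (Fin d → ℂ)) (m : ℕ) (x : Fin d → ℂ) (t : ℂ) :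
    newtonCurve F m (F x) t
      = newtonCurve F m x (t + 1) + (newtonBasis m).eval t • finDiff F (m + 1) x :=
  sum_smul_finDiff_map F (fun k => (newtonBasis k).eval t) (fun k => (newtonBasis k).eval (t + 1))
    (by simp [newtonBasis]) (fun k => eval_newtonBasis_succ_add_one k t) m x

theorem newtonVelocity_add_one (F : (Fin d → ℂ) → (Fin d → ℂ)) (m : ℕ) (x : Fin d → ℂ) (t : ℂ) :
    newtonVelocity F m (F x) t
      = newtonVelocity F m x (t + 1) + (newtonBasis m).derivative.eval t • finDiff F (m + 1) x :=
  sum_smul_finDiff_map F (fun k => (newtonBasis k).derivative.eval t)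
    (fun k => (newtonBasis k).derivative.eval (t + 1))
    (by simp [newtonBasis]) (fun k => eval_derivative_newtonBasis_succ_add_one k t) m x

theorem newtonCurve_zero (F : (Fin d → ℂ) → (Fin d → ℂ)) (m : ℕ) (x : Fin d → ℂ) :
    newtonCurve F m x 0 = x := by
  rw [newtonCurve, Finset.sum_range_succ', Finset.sum_eq_zero, eval_newtonBasis_zero]
  · simp [finDiff]
  · intro k _
    have : (newtonBasis (k + 1)).eval (0 : ℂ) = 0 := by
      simpa using eval_newtonBasis_natCast (Nat.succ_pos k)
    rw [this, zero_smul]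

theorem interpField_eq_sum_range (F : (Fin d → ℂ) → (Fin d → ℂ)) (m : ℕ) (x : Fin d → ℂ) :
    interpField F m x
      = ∑ k ∈ Finset.range m, ((-1 : ℂ) ^ k / ((k : ℂ) + 1)) • finDiff F (k + 1) x := by
  have h := Finset.sum_Ico_add' (fun k : ℕ => ((-1 : ℂ) ^ (k - 1) / (k : ℂ)) • finDiff F k x) 0 m 1
  rw [zero_add, ← Finset.range_eq_Ico] at h
  rw [interpField, show Finset.Icc 1 m = Finset.Ico 1 (m + 1) from rfl, ← h]
  simp

theorem newtonVelocity_zero (F : (Fin d → ℂ) → (Fin d → ℂ)) (m : ℕ) (x : Fin d → ℂ) :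
    newtonVelocity F m x 0 = interpField F m x := by
  rw [newtonVelocity, interpField_eq_sum_range, Finset.sum_range_succ']
  simp only [eval_derivative_newtonBasis_succ_zero]
  simp [newtonBasis]

theorem newtonCurve_natCast (F : (Fin d → ℂ) → (Fin d → ℂ)) {m i : ℕ} (hi : i ≤ m)
    (x : Fin d → ℂ) : newtonCurve F m x i = F^[i] x := by
  induction i generalizing x with
  | zero => simp [newtonCurve_zero]
  | succ i ih =>
    have h := newtonCurve_add_one F m x i
    rw [eval_newtonBasis_natCast (by omega : i < m), zero_smul, add_zero, ih (by omega)] at h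
    rw [Function.iterate_succ_apply, h]
    push_cast; rfl

/-- Moving the base point along the orbit `i` times turns time `i` into time `0`, where velocity and
field agree; each move costs one term with a difference of order `m + 1`. -/
theorem norm_newtonVelocity_sub_le (F : (Fin d → ℂ) → (Fin d → ℂ)) {m i : ℕ} {A η : ℝ}
    (hA : ∀ j < i, ‖(newtonBasis m).derivative.eval (j : ℂ)‖ ≤ A) (x : Fin d → ℂ)
    (hx : ∀ l < i, ‖finDiff F (m + 1) (F^[l] x)‖ ≤ η) :
    ‖newtonVelocity F m x i - interpField F m (F^[i] x)‖ ≤ i * (A * η) := by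
  induction i generalizing x with
  | zero => simp [newtonVelocity_zero]
  | succ i ih =>
    have h := newtonVelocity_add_one F m x i
    have ih := ih (fun j hj => hA j (by omega)) (F x) (fun l hl => by
      rw [← Function.iterate_succ_apply]; exact hx (l + 1) (by omega))
    have e : newtonVelocity F m x (i + 1 : ℕ) - interpField F m (F^[i + 1] x)
        = (newtonVelocity F m (F x) i - interpField F m (F^[i] (F x)))
          - (newtonBasis m).derivative.eval (i : ℂ) • finDiff F (m + 1) x := by
      rw [h, Function.iterate_succ_apply]; push_cast; abel
    rw [e]
    refine (norm_sub_le _ _).trans ?_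
    rw [norm_smul]
    have h1 := hA i (by omega)
    have h2 : ‖finDiff F (m + 1) x‖ ≤ η := hx 0 (by omega)
    have h3 := mul_le_mul h1 h2 (norm_nonneg _) ((norm_nonneg _).trans h1)
    push_cast
    linarith

/-! ### The family `id + μ f` and the order in `μ` of its finite differences. -/

/-- The family of maps `x ↦ x + μ f x` connecting the identity with `id + f`. -/
def stepMap (f : (Fin d → ℂ) → (Fin d → ℂ)) (μ : ℂ) (x : Fin d → ℂ) : Fin d → ℂ := x + μ • f x

theorem norm_stepMap_iterate_sub_le {f : (Fin d → ℂ) → (Fin d → ℂ)} {x₀ : Fin d → ℂ} {δ : ℝ}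
    (hb : ∀ x ∈ ball x₀ δ, ‖f x‖ ≤ 1) (μ : ℂ) {x : Fin d → ℂ} (l : ℕ)
    (hl : ‖x - x₀‖ + l * ‖μ‖ < δ) : ‖(stepMap f μ)^[l] x - x₀‖ ≤ ‖x - x₀‖ + l * ‖μ‖ := by
  induction l with
  | zero => simp
  | succ l ih =>
    push_cast at hl ⊢
    have ih := ih (by linarith [norm_nonneg μ])
    rw [Function.iterate_succ_apply', stepMap, add_sub_right_comm]
    refine (norm_add_le _ _).trans ?_
    rw [norm_smul]
    have := hb ((stepMap f μ)^[l] x) (by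
      rw [mem_ball, dist_eq_norm]; linarith [norm_nonneg μ])
    nlinarith [norm_nonneg μ]

/-- Each further difference is an increment of the previous one over a displacement of size `|μ|`,
so Cauchy's estimate gains a factor `|μ|` on a smaller ball. The constants degrade with `k`, but
only the order matters. -/
theorem exists_norm_finDiff_le {f : (Fin d → ℂ) → (Fin d → ℂ)} {x₀ : Fin d → ℂ} {δ : ℝ}
    (hδ : 0 < δ) (hf : DifferentiableOn ℂ f (ball x₀ δ)) (hb : ∀ x ∈ ball x₀ δ, ‖f x‖ ≤ 1)
    (k : ℕ) : ∃ C r : ℝ, 0 ≤ C ∧ 0 < r ∧ r ≤ δ ∧ ∀ μ ∈ ball (0 : ℂ) r,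
      DifferentiableOn ℂ (finDiff (stepMap f μ) k) (ball x₀ r) ∧
      ∀ x ∈ ball x₀ r, ‖finDiff (stepMap f μ) k x‖ ≤ C * ‖μ‖ ^ k := by
  induction k with
  | zero =>
    refine ⟨‖x₀‖ + δ, δ, by positivity, hδ, le_rfl, fun μ _ => ⟨differentiableOn_id, ?_⟩⟩
    intro x hx
    rw [mem_ball, dist_eq_norm] at hx
    have := norm_le_norm_add_norm_sub' x x₀
    simp only [finDiff, pow_zero, mul_one]
    linarith
  | succ k ih =>
    obtain ⟨C, r, hC, hr, hrδ, h⟩ := ih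
    -- With `x` within `r / 4` of `x₀` and `|μ| < r / 4`, both `x` and its image lie in the ball of
    -- radius `r / 2`, where the Lipschitz bound holds.
    refine ⟨2 * C / (r - r / 2), r / 4, div_nonneg (by positivity) (by linarith), by positivity,
      by linarith, fun μ hμ => ?_⟩
    have hμ4 := mem_ball_zero_iff.1 hμ
    obtain ⟨hd, hbd⟩ := h μ (ball_subset_ball (by linarith) hμ)
    have hsub : ball x₀ (r / 4) ⊆ ball x₀ r := ball_subset_ball (by linarith)
    have hfμ : ∀ x ∈ ball x₀ (r / 4), ‖μ • f x‖ ≤ ‖μ‖ := fun x hx => by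
      rw [norm_smul]
      exact mul_le_of_le_one_right (norm_nonneg _) (hb x (ball_subset_ball (by linarith) hx))
    have hmaps : ∀ x ∈ ball x₀ (r / 4), stepMap f μ x ∈ closedBall x₀ (r / 2) := fun x hx => by
      rw [mem_closedBall, dist_eq_norm, stepMap, add_sub_right_comm]
      rw [mem_ball, dist_eq_norm] at hx
      linarith [norm_add_le (x - x₀) (μ • f x), hfμ x (by rwa [mem_ball, dist_eq_norm])]
    constructor
    · refine DifferentiableOn.sub (hd.comp (t := ball x₀ r) ?_ fun x hx => ?_) (hd.mono hsub)
      · exact differentiableOn_id.add ((hf.mono (ball_subset_ball (by linarith))).const_smul μ)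
      · exact closedBall_subset_ball (by linarith) (hmaps x hx)
    · intro x hx
      have hL := lipschitzOnWith_closedBall_of_norm_le (r := r / 2) (by linarith) hd hbd
      have h1 := hL.norm_sub_le (hmaps x hx)
        (ball_subset_closedBall (ball_subset_ball (by linarith) hx))
      rw [Real.coe_toNNReal _ (div_nonneg (by positivity) (by linarith))] at h1
      have h2 : ‖stepMap f μ x - x‖ ≤ ‖μ‖ := by
        rw [stepMap, add_sub_cancel_left]; exact hfμ x hx
      refine h1.trans ?_
      calc _ ≤ 2 * (C * ‖μ‖ ^ k) / (r - r / 2) * ‖μ‖ := by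
            have : 0 ≤ 2 * (C * ‖μ‖ ^ k) / (r - r / 2) :=
              div_nonneg (by positivity) (by linarith)
            gcongr
        _ = _ := by rw [pow_succ]; ring

theorem exists_norm_finDiff_le_of_le {f : (Fin d → ℂ) → (Fin d → ℂ)} {x₀ : Fin d → ℂ} {δ : ℝ}
    (hδ : 0 < δ) (hf : DifferentiableOn ℂ f (ball x₀ δ)) (hb : ∀ x ∈ ball x₀ δ, ‖f x‖ ≤ 1)
    (n : ℕ) : ∃ C r : ℝ, 0 < C ∧ 0 < r ∧ r ≤ δ ∧ ∀ k ≤ n, ∀ μ ∈ ball (0 : ℂ) r,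
      DifferentiableOn ℂ (finDiff (stepMap f μ) k) (ball x₀ r) ∧
      ∀ x ∈ ball x₀ r, ‖finDiff (stepMap f μ) k x‖ ≤ C * ‖μ‖ ^ k := by
  induction n with
  | zero =>
    obtain ⟨C, r, hC, hr, hrδ, h⟩ := exists_norm_finDiff_le hδ hf hb 0
    refine ⟨C + 1, r, by linarith, hr, hrδ, fun k hk μ hμ => ?_⟩
    obtain rfl : k = 0 := by omega
    refine ⟨(h μ hμ).1, fun x hx => ((h μ hμ).2 x hx).trans ?_⟩
    gcongr; linarith
  | succ n ih =>
    obtain ⟨C, r, hC, hr, hrδ, h⟩ := exists_norm_finDiff_le hδ hf hb (n + 1)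
    obtain ⟨C', r', hC', hr', hrδ', h'⟩ := ih
    refine ⟨max C C', min r r', lt_max_of_lt_right hC', lt_min hr hr',
      (min_le_left _ _).trans hrδ, fun k hk μ hμ => ?_⟩
    have hs1 : ∀ {α : Type} [PseudoMetricSpace α] (z : α), ball z (min r r') ⊆ ball z r :=
      fun z => ball_subset_ball (min_le_left _ _)
    have hs2 : ∀ {α : Type} [PseudoMetricSpace α] (z : α), ball z (min r r') ⊆ ball z r' :=
      fun z => ball_subset_ball (min_le_right _ _)
    rcases Nat.le_succ_iff.1 hk with hk | rfl
    · have := h' k hk μ (hs2 _ hμ)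
      refine ⟨this.1.mono (hs2 _), fun x hx => (this.2 x (hs2 _ hx)).trans ?_⟩
      gcongr; exact le_max_right _ _
    · have := h μ (hs1 _ hμ)
      refine ⟨this.1.mono (hs1 _), fun x hx => (this.2 x (hs1 _ hx)).trans ?_⟩
      gcongr; exact le_max_left _ _

/-! ### Defect of Newton's curve and order of agreement of the time-one map. -/

theorem differentiableOn_interpField {F : (Fin d → ℂ) → (Fin d → ℂ)} {m : ℕ}
    {S : Set (Fin d → ℂ)} (h : ∀ k ≤ m, DifferentiableOn ℂ (finDiff F k) S) :
    DifferentiableOn ℂ (interpField F m) S := by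
  have e : interpField F m = fun x =>
      ∑ k ∈ Finset.range m, ((-1 : ℂ) ^ k / ((k : ℂ) + 1)) • finDiff F (k + 1) x :=
    funext fun x => interpField_eq_sum_range F m x
  rw [e]
  exact DifferentiableOn.fun_sum fun k hk =>
    (h (k + 1) (Finset.mem_range.1 hk)).fun_const_smul _

theorem norm_interpField_le_sum (F : (Fin d → ℂ) → (Fin d → ℂ)) (m : ℕ) (x : Fin d → ℂ) :
    ‖interpField F m x‖ ≤ ∑ k ∈ Finset.range m, ‖finDiff F (k + 1) x‖ := by
  rw [interpField_eq_sum_range]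
  refine norm_sum_le_of_le _ fun k _ => ?_
  rw [norm_smul, norm_div, norm_pow, norm_neg, norm_one, one_pow, ← Nat.cast_add_one,
    Complex.norm_natCast]
  refine mul_le_of_le_one_left (norm_nonneg _) ((div_le_one (by positivity)).2 ?_)
  exact_mod_cast Nat.succ_pos k

theorem norm_interpField_le {F : (Fin d → ℂ) → (Fin d → ℂ)} {m : ℕ} {C u : ℝ} {x : Fin d → ℂ}
    (hC : 0 ≤ C) (hu : 0 ≤ u) (hu1 : u ≤ 1)
    (h : ∀ k ≤ m, ‖finDiff F k x‖ ≤ C * u ^ k) : ‖interpField F m x‖ ≤ m * (C * u) := by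
  refine (norm_interpField_le_sum F m x).trans ?_
  refine (Finset.sum_le_card_nsmul _ _ (C * u) fun k hk => ?_).trans_eq (by simp)
  refine (h (k + 1) (Finset.mem_range.1 hk)).trans ?_
  gcongr
  exact pow_le_of_le_one hu hu1 (Nat.succ_ne_zero k)

/-- The `k`-th term is at most `C ((|t| + k) u) ^ k`, so the curve stays near `x` for complex times
up to `ρ / u`, inversely proportional to the displacement. -/
theorem norm_newtonCurve_sub_le {F : (Fin d → ℂ) → (Fin d → ℂ)} {m : ℕ} {C u ρ : ℝ}
    {x : Fin d → ℂ} (hC : 0 ≤ C) (hu : 0 ≤ u) (h : ∀ k ≤ m, ‖finDiff F k x‖ ≤ C * u ^ k)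
    (hρ : ρ ≤ 1 / 2) (hmu : m * u ≤ ρ) {t : ℂ} (ht : ‖t‖ * u ≤ ρ) :
    ‖newtonCurve F m x t - x‖ ≤ m * (C * (2 * ρ)) := by
  have hρ0 : 0 ≤ ρ := le_trans (by positivity) ht
  have e : newtonCurve F m x t - x
      = ∑ k ∈ Finset.range m, (newtonBasis (k + 1)).eval t • finDiff F (k + 1) x := by
    rw [newtonCurve, Finset.sum_range_succ', eval_newtonBasis_zero]
    simp [finDiff]
  rw [e]
  refine (norm_sum_le_of_le _ (f := fun k => (newtonBasis (k + 1)).eval t • finDiff F (k + 1) x)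
    (n := fun _ => C * (2 * ρ)) fun k hk => ?_).trans_eq (by simp)
  have hk : k + 1 ≤ m := Finset.mem_range.1 hk
  have hk' : ((k + 1 : ℕ) : ℝ) * u ≤ ρ := le_trans (by gcongr) hmu
  rw [norm_smul]
  calc _ ≤ (‖t‖ + (k + 1 : ℕ)) ^ (k + 1) * (C * u ^ (k + 1)) := by
        gcongr
        · exact norm_eval_newtonBasis_le _ _
        · exact h _ hk
    _ = C * ((‖t‖ * u + (k + 1 : ℕ) * u)) ^ (k + 1) := by rw [← add_mul, mul_pow]; ring
    _ ≤ C * (2 * ρ) ^ (k + 1) := by gcongr; linarith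
    _ ≤ C * (2 * ρ) := by
        gcongr
        exact pow_le_of_le_one (by linarith) (by linarith) (Nat.succ_ne_zero k)

theorem differentiable_newtonVelocity (F : (Fin d → ℂ) → (Fin d → ℂ)) (m : ℕ) (x : Fin d → ℂ) :
    Differentiable ℂ (newtonVelocity F m x) :=
  Differentiable.fun_sum fun k _ =>
    ((newtonBasis k).derivative.differentiable).smul_const (finDiff F k x)

/-- Newton's interpolating curve solves the equation `γ' = X_m γ` up to order `m`. -/
theorem exists_norm_newtonVelocity_sub_le (m : ℕ) {C r ρ : ℝ} (hC : 0 < C)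
    (hr : 0 < r) (hρ0 : 0 < ρ) (hρ : ρ ≤ 1 / 2) (hρr : m * (C * (2 * ρ)) ≤ r / 4) :
    ∃ A : ℝ, 0 ≤ A ∧ ∀ (F : (Fin d → ℂ) → (Fin d → ℂ)) (x₀ : Fin d → ℂ) (u : ℝ), 0 < u →
      (4 * m + 4) * u ≤ ρ →
      (∀ k ≤ m, DifferentiableOn ℂ (finDiff F k) (ball x₀ r)) →
      (∀ k ≤ m + 1, ∀ x ∈ ball x₀ r, ‖finDiff F k x‖ ≤ C * u ^ k) →
      (∀ l < m, F^[l] x₀ ∈ ball x₀ r) →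
      ∀ t : ℂ, ‖t‖ ≤ 1 → ‖newtonVelocity F m x₀ t - interpField F m (newtonCurve F m x₀ t)‖
        ≤ A * u ^ (m + 1) := by
  obtain ⟨Cn, hCn, hnode⟩ := exists_norm_le_of_norm_nodes_le (E := Fin d → ℂ) m
  set D : ℝ := ∑ j ∈ Finset.range m, ‖(newtonBasis m).derivative.eval (j : ℂ)‖ with hD
  have hD0 : 0 ≤ D := Finset.sum_nonneg fun _ _ => norm_nonneg _
  refine ⟨Cn * (m * (D * C) + (r / ρ + m * C) * (2 / ρ) ^ m), by positivity, ?_⟩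
  intro F x₀ u hu hmu hd hb hl t ht
  -- On this disk the curve stays in the domain of the field. The defect is `O(u)` there, so
  -- dividing by `R ^ m` yields `O(u ^ (m + 1))`; the hypothesis on `u` makes `R / 2 ≥ 2 m + 2`, as
  -- the node lemma requires.
  set R : ℝ := ρ / u with hR
  have hRu : R * u = ρ := by rw [hR]; field_simp
  have hR0 : 0 < R := by positivity
  have hR4 : 4 * m + 4 ≤ R := by rw [hR, le_div_iff₀ hu]; exact hmu
  have hu1 : u ≤ 1 := by nlinarith [(Nat.cast_nonneg m : (0 : ℝ) ≤ m)]
  have hmu' : m * u ≤ ρ := by nlinarith [(Nat.cast_nonneg m : (0 : ℝ) ≤ m)]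
  have hx₀ : x₀ ∈ ball x₀ r := mem_ball_self hr
  have hP : ∀ s ∈ ball (0 : ℂ) R, ‖newtonCurve F m x₀ s - x₀‖ ≤ r / 4 := fun s hs =>
    (norm_newtonCurve_sub_le hC.le hu.le (fun k hk => hb k (by omega) x₀ hx₀) hρ hmu' (by
      rw [← hRu]; gcongr; exact (mem_ball_zero_iff.1 hs).le)).trans hρr
  have hPmem : ∀ s ∈ ball (0 : ℂ) R, newtonCurve F m x₀ s ∈ ball x₀ r := fun s hs => by
    rw [mem_ball, dist_eq_norm]; linarith [hP s hs]
  have hsub : ball (0 : ℂ) (R / 2) ⊆ ball 0 R := ball_subset_ball (by linarith)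
  have hV : ∀ s ∈ ball (0 : ℂ) (R / 2), ‖newtonVelocity F m x₀ s‖ ≤ r / ρ * u := fun s hs => by
    have hder := (hasDerivAt_newtonCurve F m x₀ s).sub_const x₀
    rw [← hder.deriv]
    refine (Complex.norm_deriv_le_of_forall_mem_sphere_norm_le (R := R / 4) (C := r / 4)
      (by positivity) (Differentiable.diffContOnCl fun z =>
        ((hasDerivAt_newtonCurve F m x₀ z).sub_const x₀).differentiableAt)
      (fun z hz => hP z ?_)).trans_eq ?_
    · rw [mem_ball_zero_iff] at hs ⊢
      rw [mem_sphere, dist_eq_norm] at hz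
      linarith [norm_le_norm_add_norm_sub' z s]
    · rw [hR]; field_simp
  have hXd : DifferentiableOn ℂ (interpField F m) (ball x₀ r) := differentiableOn_interpField hd
  have hX : ∀ s ∈ ball (0 : ℂ) R, ‖interpField F m (newtonCurve F m x₀ s)‖ ≤ m * C * u :=
    fun s hs => (norm_interpField_le hC.le hu.le hu1
      fun k hk => hb k (by omega) _ (hPmem s hs)).trans_eq (by ring)
  have hnodes : ∀ i < m, ‖newtonVelocity F m x₀ i - interpField F m (newtonCurve F m x₀ i)‖
      ≤ m * (D * (C * u ^ (m + 1))) := by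
    intro i hi
    rw [newtonCurve_natCast F hi.le]
    refine (norm_newtonVelocity_sub_le F (A := D) (η := C * u ^ (m + 1)) (fun j hj => ?_) x₀
      fun l hli => hb (m + 1) le_rfl _ (hl l (by omega))).trans (by gcongr)
    exact Finset.single_le_sum (f := fun j : ℕ => ‖(newtonBasis m).derivative.eval (j : ℂ)‖)
      (fun _ _ => norm_nonneg _) (Finset.mem_range.2 (by omega))
  have key := hnode (R / 2) (r / ρ * u + m * C * u) (m * (D * (C * u ^ (m + 1))))
    (fun s => newtonVelocity F m x₀ s - interpField F m (newtonCurve F m x₀ s)) (by linarith)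
    ((differentiable_newtonVelocity F m x₀).differentiableOn.sub
      (hXd.comp (fun s _ => (hasDerivAt_newtonCurve F m x₀ s).differentiableAt.differentiableWithinAt)
        fun s hs => hPmem s (hsub hs)))
    (fun s hs => (norm_sub_le _ _).trans (add_le_add (hV s hs) (hX s (hsub hs))))
    hnodes (by positivity) t ht
  refine key.trans_eq ?_
  rw [hR, div_pow, div_pow, div_pow, pow_succ]
  field_simp

theorem newtonCurve_one (F : (Fin d → ℂ) → (Fin d → ℂ)) {m : ℕ} (hm : 1 ≤ m) (x : Fin d → ℂ) :
    newtonCurve F m x 1 = F x := by simpa using newtonCurve_natCast F hm x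

/-- The time-one map of the interpolating vector field of order `m` of a near-identity map agrees
with that map up to order `m`. -/
theorem exists_norm_integralCurve_sub_stepMap_le {f : (Fin d → ℂ) → (Fin d → ℂ)}
    {x₀ : Fin d → ℂ} {δ c : ℝ} (hδ : 0 < δ) (hf : DifferentiableOn ℂ f (ball x₀ δ))
    (hb : ∀ x ∈ ball x₀ δ, ‖f x‖ ≤ 1) {m : ℕ} (hm : 1 ≤ m) (hc : 0 ≤ c) :
    ∃ A s : ℝ, 0 < s ∧ ∀ μ ∈ ball (0 : ℂ) s, ∀ γ : ℝ → (Fin d → ℂ), γ 0 = x₀ →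
      (∀ t ∈ Icc (0 : ℝ) 1, γ t ∈ closedBall x₀ (c * ‖μ‖)) →
      IsIntegralCurveOn γ (fun _ => interpField (stepMap f μ) m) (Icc 0 1) →
      ‖γ 1 - stepMap f μ x₀‖ ≤ A * ‖μ‖ ^ (m + 1) := by
  obtain ⟨C, r, hC, hr, hrδ, h⟩ := exists_norm_finDiff_le_of_le hδ hf hb (m + 1)
  have hm0 : (1 : ℝ) ≤ m := by exact_mod_cast hm
  -- The last term keeps Newton's curve within `r / 4` of `x₀` and gives the field Lipschitz
  -- constant at most one on the ball of radius `r / 2`.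
  set ρ : ℝ := min (min (1 / 2) r) (r / (8 * m * C)) with hρdef
  have hρ0 : 0 < ρ := lt_min (lt_min (by norm_num) hr) (by positivity)
  have hρ1 : ρ ≤ 1 / 2 := (min_le_left _ _).trans (min_le_left _ _)
  have hρr : ρ ≤ r := (min_le_left _ _).trans (min_le_right _ _)
  have hρC : 8 * m * C * ρ ≤ r := by
    have : ρ ≤ r / (8 * m * C) := min_le_right _ _
    rw [le_div_iff₀ (by positivity)] at this
    linarith
  obtain ⟨A, hA, hmain⟩ := exists_norm_newtonVelocity_sub_le (d := d) m hC hr hρ0 hρ1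
    (by linarith)
  refine ⟨gronwallBound 0 1 A 1, min (ρ / (4 * m + 4)) (r / (2 * (c + 1))),
    lt_min (by positivity) (by positivity), fun μ hμ γ hγ0 hγm hγ => ?_⟩
  have hμ := mem_ball_zero_iff.1 hμ
  have h1 : (4 * m + 4) * ‖μ‖ ≤ ρ := by
    have := (hμ.trans_le (min_le_left _ _)).le
    rw [le_div_iff₀ (by positivity)] at this
    linarith
  have h2 : c * ‖μ‖ ≤ r / 2 := by
    have := (hμ.trans_le (min_le_right _ _)).le
    rw [le_div_iff₀ (by positivity)] at this
    linarith [norm_nonneg μ]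
  rcases eq_or_ne μ 0 with rfl | hne
  · have := hγm 1 (by simp)
    simp only [norm_zero, mul_zero, closedBall_zero, mem_singleton_iff] at this
    simp [this, stepMap]
  have hu : 0 < ‖μ‖ := norm_pos_iff.2 hne
  have hmu0 : 0 ≤ m * ‖μ‖ := by positivity
  have hu1 : ‖μ‖ ≤ 1 := by linarith
  have hur : ‖μ‖ < r := by linarith
  have hmu : m * ‖μ‖ ≤ ρ := by linarith
  have hΔ := fun k (hk : k ≤ m + 1) => h k hk μ (mem_ball_zero_iff.2 hur)
  set F := stepMap f μ
  have hV := hmain F x₀ ‖μ‖ hu h1 (fun k hk => (hΔ k (by omega)).1) (fun k hk => (hΔ k hk).2)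
    (fun l hl => by
      have hlm : (l : ℝ) * ‖μ‖ ≤ m * ‖μ‖ := by gcongr
      have hl0 : ‖x₀ - x₀‖ + l * ‖μ‖ < r := by rw [sub_self, norm_zero]; linarith
      rw [mem_ball, dist_eq_norm]
      exact (norm_stepMap_iterate_sub_le hb μ l (hl0.trans_le hrδ)).trans_lt hl0)
  have hLip : LipschitzOnWith 1 (interpField F m) (closedBall x₀ (r / 2)) := by
    refine (lipschitzOnWith_closedBall_of_norm_le (M := m * (C * ‖μ‖)) (by linarith)
      (differentiableOn_interpField fun k hk => (hΔ k (by omega)).1)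
      (fun x hx => norm_interpField_le hC.le hu.le hu1
        fun k hk => (hΔ k (by omega)).2 x hx)).weaken ?_
    rw [← NNReal.coe_le_coe, Real.coe_toNNReal', NNReal.coe_one]
    refine max_le ((div_le_one (by linarith)).2 ?_) zero_le_one
    have : m * (C * ‖μ‖) ≤ m * (C * ρ) := by
      gcongr; linarith
    linarith
  have hder : ∀ t : ℝ, HasDerivAt (fun s : ℝ => newtonCurve F m x₀ (s : ℂ))
      (newtonVelocity F m x₀ (t : ℂ)) t := fun t => by
    have := (hasDerivAt_newtonCurve F m x₀ (t : ℂ)).scomp t Complex.ofRealCLM.hasDerivAt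
    rw [Complex.ofRealCLM_apply, Complex.ofReal_one, one_smul] at this
    exact this
  have hnorm : ∀ t ∈ Ico (0 : ℝ) 1, ‖(t : ℂ)‖ ≤ 1 := fun t ht => by
    rw [Complex.norm_real, Real.norm_of_nonneg ht.1]; exact ht.2.le
  -- Grönwall: `γ` is an exact solution, Newton's curve an approximate one with the same origin.
  have hg := dist_le_of_approx_trajectories_ODE_of_mem (K := 1) (a := 0) (b := 1)
    (v := fun _ => interpField F m) (s := fun _ => closedBall x₀ (r / 2))
    (f := γ) (g := fun s : ℝ => newtonCurve F m x₀ (s : ℂ))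
    (f' := fun t => interpField F m (γ t)) (g' := fun t => newtonVelocity F m x₀ (t : ℂ))
    (εf := 0) (εg := A * ‖μ‖ ^ (m + 1)) (δ := 0)
    (fun _ _ => hLip) hγ.continuousOn
    (fun t ht => (hγ t (Ico_subset_Icc_self ht)).mono_of_mem_nhdsWithin
      (mem_of_superset (Icc_mem_nhdsGE ht.2) (Icc_subset_Icc_left ht.1)))
    (fun t _ => by simp)
    (fun t ht => closedBall_subset_closedBall h2 (hγm t (Ico_subset_Icc_self ht)))
    (fun t _ => (hder t).continuousAt.continuousWithinAt)
    (fun t _ => (hder t).hasDerivWithinAt)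
    (fun t ht => by rw [dist_eq_norm]; exact hV t (hnorm t ht))
    (fun t ht => by
      rw [mem_closedBall, dist_eq_norm]
      refine (norm_newtonCurve_sub_le hC.le hu.le
        (fun k hk => (hΔ k (by omega)).2 x₀ (mem_ball_self hr)) hρ1 hmu ?_).trans (by linarith)
      have := mul_le_of_le_one_left hu.le (hnorm t ht)
      linarith)
    (by simp [hγ0, newtonCurve_zero]) 1 (by simp)
  rw [Complex.ofReal_one, newtonCurve_one F hm, dist_eq_norm] at hg
  refine hg.trans_eq ?_
  rw [gronwallBound_of_K_ne_0 (by simp), gronwallBound_of_K_ne_0 (by simp)]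
  simp
  ring

/-! ### Explicit bounds from Schwarz's lemma in `μ`. -/

/-- Schwarz's lemma for a bounded function with a zero of order `n + 1` at the origin. -/
theorem norm_le_mul_div_pow_of_norm_le_pow {h : ℂ → (Fin d → ℂ)} {r s B C : ℝ} {n : ℕ}
    (hd : DifferentiableOn ℂ h (ball 0 r)) (hB : ∀ μ ∈ ball (0 : ℂ) r, ‖h μ‖ ≤ B) (hs : 0 < s)
    (hC : ∀ μ ∈ ball (0 : ℂ) s, ‖h μ‖ ≤ C * ‖μ‖ ^ (n + 1)) {μ : ℂ} (hμ : μ ∈ ball (0 : ℂ) r) :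
    ‖h μ‖ ≤ B * (‖μ‖ / r) ^ (n + 1) := by
  have h0 : h 0 = 0 := by simpa using hC 0 (mem_ball_self hs)
  have hO : (fun μ => h μ - h 0) =o[𝓝 0] fun w : ℂ => ‖w - 0‖ ^ n := by
    simp only [h0, sub_zero]
    refine Asymptotics.IsBigO.trans_isLittleO (g := fun w : ℂ => ‖w‖ ^ (n + 1)) ?_
      (Asymptotics.isLittleO_norm_pow_norm_pow (Nat.lt_succ_self n))
    refine Asymptotics.IsBigO.of_bound C ?_
    filter_upwards [ball_mem_nhds (0 : ℂ) hs] with w hw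
    simpa using hC w hw
  have := Complex.dist_le_mul_div_pow_of_mapsTo_ball_of_isLittleO hd
    (fun w hw => by simpa [h0] using hB w hw) hO hμ
  simpa [h0] using this

/-- The bound merely doubles with each difference, but nothing is lost beyond the room `k |μ|` that
the orbit needs. Analyticity is joint in `(μ, x)` because both variables move in the flow argument.
-/
theorem analyticAt_finDiff_stepMap {f : (Fin d → ℂ) → (Fin d → ℂ)} {x₀ : Fin d → ℂ} {δ : ℝ}
    (hf : AnalyticOnNhd ℂ f (ball x₀ δ)) (hb : ∀ x ∈ ball x₀ δ, ‖f x‖ ≤ 1) (k : ℕ) (μ : ℂ)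
    (x : Fin d → ℂ) (h : ‖x - x₀‖ + k * ‖μ‖ < δ) :
    AnalyticAt ℂ (fun p : ℂ × (Fin d → ℂ) => finDiff (stepMap f p.1) (k + 1) p.2) (μ, x) ∧
      ‖finDiff (stepMap f μ) (k + 1) x‖ ≤ 2 ^ k * ‖μ‖ := by
  have hμ := norm_nonneg μ
  have hx : x ∈ ball x₀ δ := by
    rw [mem_ball, dist_eq_norm]
    have : 0 ≤ k * ‖μ‖ := by positivity
    linarith
  have hfx : ‖μ • f x‖ ≤ ‖μ‖ := by
    rw [norm_smul]; exact mul_le_of_le_one_right hμ (hb x hx)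
  have hfa : AnalyticAt ℂ (fun p : ℂ × (Fin d → ℂ) => p.1 • f p.2) (μ, x) :=
    analyticAt_fst.smul (AnalyticAt.fun_comp (hf x hx) analyticAt_snd)
  induction k generalizing x with
  | zero =>
    have e : ∀ (ν : ℂ) y, finDiff (stepMap f ν) 1 y = ν • f y := fun ν y => by
      simp [finDiff, stepMap]
    simp only [zero_add, e, pow_zero, one_mul]
    exact ⟨hfa, hfx⟩
  | succ k ih =>
    push_cast at h
    have h1 : ‖stepMap f μ x - x₀‖ + k * ‖μ‖ < δ := by
      rw [stepMap, add_sub_right_comm]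
      linarith [norm_add_le (x - x₀) (μ • f x)]
    have hs : stepMap f μ x ∈ ball x₀ δ := by
      rw [mem_ball, dist_eq_norm]
      have : 0 ≤ k * ‖μ‖ := by positivity
      linarith
    have hfs : ‖μ • f (stepMap f μ x)‖ ≤ ‖μ‖ := by
      rw [norm_smul]; exact mul_le_of_le_one_right hμ (hb _ hs)
    obtain ⟨ha1, hb1⟩ := ih (stepMap f μ x) h1 hs hfs
      (analyticAt_fst.smul (AnalyticAt.fun_comp (hf _ hs) analyticAt_snd))
    obtain ⟨ha2, hb2⟩ := ih x (by linarith) hx hfx hfa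
    constructor
    · have hg : AnalyticAt ℂ (fun p : ℂ × (Fin d → ℂ) => (p.1, stepMap f p.1 p.2)) (μ, x) :=
        analyticAt_fst.prod (analyticAt_snd.add hfa)
      exact (ha1.comp_of_eq hg rfl).sub ha2
    · have e : finDiff (stepMap f μ) (k + 1 + 1) x
          = finDiff (stepMap f μ) (k + 1) (stepMap f μ x) - finDiff (stepMap f μ) (k + 1) x := rfl
      rw [e, pow_succ]
      linarith [norm_sub_le (finDiff (stepMap f μ) (k + 1) (stepMap f μ x))
        (finDiff (stepMap f μ) (k + 1) x)]

theorem norm_finDiff_stepMap_le {f : (Fin d → ℂ) → (Fin d → ℂ)} {x₀ : Fin d → ℂ} {δ μ₁ : ℝ}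
    (hf : AnalyticOnNhd ℂ f (ball x₀ δ)) (hb : ∀ x ∈ ball x₀ δ, ‖f x‖ ≤ 1) {k : ℕ}
    {x : Fin d → ℂ} (hx : ‖x - x₀‖ + k * μ₁ < δ) {μ : ℂ} (hμ : μ ∈ ball (0 : ℂ) μ₁) :
    ‖finDiff (stepMap f μ) (k + 1) x‖ ≤ 2 ^ k * μ₁ * (‖μ‖ / μ₁) ^ (k + 1) := by
  have hμ₁ : 0 < μ₁ := (norm_nonneg μ).trans_lt (mem_ball_zero_iff.1 hμ)
  have hsub : ball x (δ - ‖x - x₀‖) ⊆ ball x₀ δ := ball_subset_ball' (by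
    rw [dist_eq_norm]; linarith)
  have hxδ : 0 < δ - ‖x - x₀‖ := by
    have : 0 ≤ k * μ₁ := by positivity
    linarith
  obtain ⟨C, r, _, hr, _, h⟩ := exists_norm_finDiff_le hxδ (hf.differentiableOn.mono hsub)
    (fun y hy => hb y (hsub hy)) (k + 1)
  have key : ∀ ν ∈ ball (0 : ℂ) μ₁, ‖x - x₀‖ + k * ‖ν‖ < δ := fun ν hν => by
    have : k * ‖ν‖ ≤ k * μ₁ := by gcongr; exact (mem_ball_zero_iff.1 hν).le
    linarith
  refine norm_le_mul_div_pow_of_norm_le_pow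
    (h := fun ν => finDiff (stepMap f ν) (k + 1) x) (fun ν hν => ?_) (fun ν hν => ?_) hr
    (fun ν hν => (h ν hν).2 x (mem_ball_self hr)) hμ
  · have hg : AnalyticAt ℂ (fun ν : ℂ => (ν, x)) ν := analyticAt_id.prod analyticAt_const
    have ha := (analyticAt_finDiff_stepMap hf hb k ν x (key ν hν)).1
    exact (ha.comp_of_eq hg rfl).differentiableAt.differentiableWithinAt
  · refine (analyticAt_finDiff_stepMap hf hb k ν x (key ν hν)).2.trans ?_
    gcongr
    exact (mem_ball_zero_iff.1 hν).le

theorem norm_interpField_stepMap_le {f : (Fin d → ℂ) → (Fin d → ℂ)} {x₀ : Fin d → ℂ} {δ : ℝ}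
    (hf : AnalyticOnNhd ℂ f (ball x₀ δ)) (hb : ∀ x ∈ ball x₀ δ, ‖f x‖ ≤ 1) {m : ℕ} {μ : ℂ}
    (hμ : 6 * ((m : ℝ) - 1) * ‖μ‖ ≤ δ) {x : Fin d → ℂ} (hx : ‖x - x₀‖ < δ / 3) :
    ‖interpField (stepMap f μ) m x‖ ≤ 2 * ‖μ‖ := by
  have hδ : 0 < δ := by linarith [norm_nonneg (x - x₀)]
  have hterm : ∀ k < m, ‖finDiff (stepMap f μ) (k + 1) x‖ ≤ ‖μ‖ * (1 / 2) ^ k := by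
    intro k hk
    rcases Nat.eq_zero_or_pos k with rfl | hk0
    · have := (analyticAt_finDiff_stepMap hf hb 0 μ x (by norm_num; linarith)).2
      simpa using this
    · have hk0' : (0 : ℝ) < k := by exact_mod_cast hk0
      have hkm : (k : ℝ) ≤ m - 1 := by
        have : (k : ℝ) + 1 ≤ m := by exact_mod_cast hk
        linarith
      -- The largest radius allowed: `k μ₁ = 2 δ / 3` is the room left once `x` is within `δ / 3` of
      -- `x₀`. From `6 k |μ| ≤ δ` follows `4 |μ| ≤ μ₁`, hence the ratio `2 |μ| / μ₁ ≤ 1 / 2`.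
      set μ₁ : ℝ := 2 * δ / (3 * k) with hμ₁
      have hpos : 0 < μ₁ := by positivity
      have hkμ : k * μ₁ = 2 * δ / 3 := by rw [hμ₁]; field_simp
      have h4 : 4 * ‖μ‖ ≤ μ₁ := by
        rw [hμ₁, le_div_iff₀ (by positivity)]
        have : (k : ℝ) * ‖μ‖ ≤ (m - 1) * ‖μ‖ := by gcongr
        linarith
      have := norm_finDiff_stepMap_le hf hb (k := k) (μ₁ := μ₁) (x := x) (by linarith)
        (μ := μ) (mem_ball_zero_iff.2 (by linarith [norm_nonneg μ]))
      refine this.trans ?_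
      calc 2 ^ k * μ₁ * (‖μ‖ / μ₁) ^ (k + 1) = ‖μ‖ * (2 * ‖μ‖ / μ₁) ^ k := by
            rw [mul_div_assoc, mul_pow, pow_succ]
            linear_combination (2 ^ k * (‖μ‖ / μ₁) ^ k) * mul_div_cancel₀ ‖μ‖ hpos.ne'
        _ ≤ ‖μ‖ * (1 / 2) ^ k := by
            have : 2 * ‖μ‖ / μ₁ ≤ 1 / 2 := by rw [div_le_iff₀ hpos]; linarith
            gcongr
  refine (norm_interpField_le_sum _ m x).trans ?_
  refine (Finset.sum_le_sum fun k hk => hterm k (Finset.mem_range.1 hk)).trans ?_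
  rw [← Finset.mul_sum, mul_comm]
  exact mul_le_mul_of_nonneg_right (sum_geometric_two_le m) (norm_nonneg _)

theorem differentiableOn_interpField_stepMap {f : (Fin d → ℂ) → (Fin d → ℂ)} {x₀ : Fin d → ℂ}
    {δ : ℝ} (hf : AnalyticOnNhd ℂ f (ball x₀ δ)) (hb : ∀ x ∈ ball x₀ δ, ‖f x‖ ≤ 1) {m : ℕ}
    {S : Set (ℂ × (Fin d → ℂ))} (hS : ∀ p ∈ S, ∀ k < m, ‖p.2 - x₀‖ + k * ‖p.1‖ < δ) :
    DifferentiableOn ℂ (fun p : ℂ × (Fin d → ℂ) => interpField (stepMap f p.1) m p.2) S := by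
  have e : (fun p : ℂ × (Fin d → ℂ) => interpField (stepMap f p.1) m p.2)
      = fun p => ∑ k ∈ Finset.range m,
        ((-1 : ℂ) ^ k / ((k : ℂ) + 1)) • finDiff (stepMap f p.1) (k + 1) p.2 :=
    funext fun p => interpField_eq_sum_range _ m _
  rw [e]
  refine DifferentiableOn.fun_sum fun k hk => ?_
  have hk' : DifferentiableOn ℂ
      (fun p : ℂ × (Fin d → ℂ) => finDiff (stepMap f p.1) (k + 1) p.2) S := fun p hp =>
    (analyticAt_finDiff_stepMap hf hb k p.1 p.2
      (hS p hp k (Finset.mem_range.1 hk))).1.differentiableAt.differentiableWithinAt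
  exact hk'.fun_const_smul _

theorem differentiableOn_comp_mk_left {X : ℂ × (Fin d → ℂ) → (Fin d → ℂ)} {s : Set ℂ}
    {t : Set (Fin d → ℂ)} (h : DifferentiableOn ℂ X (s ×ˢ t)) {μ : ℂ} (hμ : μ ∈ s) :
    DifferentiableOn ℂ (fun x => X (μ, x)) t :=
  h.comp ((differentiableOn_const μ).prodMk differentiableOn_id) fun _ hx => ⟨hμ, hx⟩

/-- The time-one map of the interpolating vector field, with the error bound obtained from
Schwarz's lemma in the parameter of the family `stepMap f`. -/
theorem exists_integralCurve_interpField {f : (Fin d → ℂ) → (Fin d → ℂ)} {x₀ : Fin d → ℂ}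
    {δ c R μ₀ : ℝ} (hf : AnalyticOnNhd ℂ f (ball x₀ δ)) (hb : ∀ x ∈ ball x₀ δ, ‖f x‖ ≤ 1)
    {m : ℕ} (hm : 1 ≤ m) (hc : 0 < c) (hμ₀ : 0 < μ₀) (hcR : c * μ₀ ≤ R)
    (hgeo : ∀ μ ∈ ball (0 : ℂ) μ₀, ∀ x ∈ ball x₀ R, ∀ k < m, ‖x - x₀‖ + k * ‖μ‖ < δ)
    (hX : ∀ μ ∈ ball (0 : ℂ) μ₀, ∀ x ∈ ball x₀ R, ‖interpField (stepMap f μ) m x‖ ≤ c * ‖μ‖)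
    {μ : ℂ} (hμ : μ ∈ ball (0 : ℂ) μ₀) :
    ∃ γ : ℝ → (Fin d → ℂ), γ 0 = x₀ ∧ (∀ t, γ t ∈ closedBall x₀ (c * ‖μ‖)) ∧
      IsIntegralCurveOn γ (fun _ => interpField (stepMap f μ) m) (Icc 0 1) ∧
      ‖γ 1 - stepMap f μ x₀‖ ≤ (c + 1) * μ₀ * (‖μ‖ / μ₀) ^ (m + 1) := by
  have hR : 0 < R := lt_of_lt_of_le (by positivity) hcR
  have hδ : 0 < δ := by simpa using hgeo 0 (mem_ball_self hμ₀) x₀ (mem_ball_self hR) 0 hm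
  have hlt : ∀ ν ∈ ball (0 : ℂ) μ₀, c * ‖ν‖ < R := fun ν hν =>
    (mul_lt_mul_of_pos_left (mem_ball_zero_iff.1 hν) hc).trans_le hcR
  have hjoint : DifferentiableOn ℂ
      (fun p : ℂ × (Fin d → ℂ) => interpField (stepMap f p.1) m p.2)
      (ball 0 μ₀ ×ˢ ball x₀ R) :=
    differentiableOn_interpField_stepMap hf hb fun p hp => hgeo p.1 hp.1 p.2 hp.2
  have hex : ∀ ν : ℂ, ∃ γ : ℝ → (Fin d → ℂ), ν ∈ ball (0 : ℂ) μ₀ →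
      γ 0 = x₀ ∧ (∀ t, γ t ∈ closedBall x₀ (c * ‖ν‖)) ∧
      IsIntegralCurveOn γ (fun _ => interpField (stepMap f ν) m) (Icc 0 1) := by
    intro ν
    by_cases hν : ν ∈ ball (0 : ℂ) μ₀
    · have hdν : DifferentiableOn ℂ (interpField (stepMap f ν) m) (ball x₀ R) :=
        differentiableOn_comp_mk_left hjoint hν
      have hL := lipschitzOnWith_closedBall_of_norm_le (hlt ν hν) hdν (hX ν hν)
      obtain ⟨γ, hγ⟩ := exists_integralCurve_Icc (by positivity) hL
        fun x hx => hX ν hν x (closedBall_subset_ball (hlt ν hν) hx)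
      exact ⟨γ, fun _ => hγ⟩
    · exact ⟨0, fun h => absurd h hν⟩
  choose γ hγ using hex
  refine ⟨γ μ, (hγ μ hμ).1, (hγ μ hμ).2.1, (hγ μ hμ).2.2, ?_⟩
  obtain ⟨A, s, hs, hA⟩ := exists_norm_integralCurve_sub_stepMap_le hδ hf.differentiableOn hb hm
    hc.le
  have hflow := differentiableOn_integralCurve_one hc hcR hjoint hX (fun ν hν => (hγ ν hν).1)
    (fun ν hν t _ => (hγ ν hν).2.1 t) (fun ν hν => (hγ ν hν).2.2)
  -- Both endpoints are close to `x₀`: the flow moves it by at most `c μ₀`, the map by at most `μ₀`,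
  -- whence the factor `(c + 1) μ₀`.
  refine norm_le_mul_div_pow_of_norm_le_pow (h := fun ν => γ ν 1 - stepMap f ν x₀)
    (s := min s μ₀) (C := A) ?_ ?_ (lt_min hs hμ₀) ?_ hμ
  · refine hflow.sub (DifferentiableOn.add (differentiableOn_const _) ?_)
    exact (differentiable_id.smul_const (f x₀)).differentiableOn
  · intro ν hν
    have h1 := (hγ ν hν).2.1 1
    rw [mem_closedBall, dist_eq_norm] at h1
    have h2 : ‖ν • f x₀‖ ≤ ‖ν‖ := by
      rw [norm_smul]
      exact mul_le_of_le_one_right (norm_nonneg _) (hb x₀ (mem_ball_self hδ))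
    have e : γ ν 1 - stepMap f ν x₀ = (γ ν 1 - x₀) - ν • f x₀ := by rw [stepMap]; abel
    have h3 : c * ‖ν‖ ≤ c * μ₀ := by gcongr; exact (mem_ball_zero_iff.1 hν).le
    simp only [e]
    linarith [norm_sub_le (γ ν 1 - x₀) (ν • f x₀), mem_ball_zero_iff.1 hν]
  · intro ν hν
    have hν' := ball_subset_ball (min_le_right s μ₀) hν
    exact hA ν (ball_subset_ball (min_le_left s μ₀) hν) (γ ν) (hγ ν hν').1
      (fun t _ => (hγ ν hν').2.1 t) (hγ ν hν').2.2

/-! ### Flow maps from solutions, and the constants `c₀` and `M_α`. -/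

theorem supNorm_le_ofReal_iff {D : Set (Fin d → ℂ)} {g : (Fin d → ℂ) → (Fin d → ℂ)} {B : ℝ}
    (hB : 0 ≤ B) : supNorm D g ≤ ENNReal.ofReal B ↔ ∀ x ∈ D, ‖g x‖ ≤ B := by
  simp only [supNorm, iSup₂_le_iff, ← ofReal_norm, ENNReal.ofReal_le_ofReal_iff hB]

theorem analyticOnNhd_finDiff {D : Set (Fin d → ℂ)} {F : (Fin d → ℂ) → (Fin d → ℂ)}
    (hF : AnalyticOnNhd ℂ F D) (k : ℕ) :
    AnalyticOnNhd ℂ (finDiff F k) (interpDomain D F k) := by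
  induction k with
  | zero => exact analyticOnNhd_id
  | succ k ih =>
    intro x hx
    have h0 : x ∈ D := hx 0 (Nat.succ_pos k)
    have h1 : F x ∈ interpDomain D F k := fun i hi => by
      rw [← Function.iterate_succ_apply]; exact hx (i + 1) (by omega)
    exact ((ih (F x) h1).comp (hF x h0)).sub (ih x fun i hi => hx i (by omega))

theorem analyticOnNhd_interpField {D : Set (Fin d → ℂ)} {F : (Fin d → ℂ) → (Fin d → ℂ)}
    (hF : AnalyticOnNhd ℂ F D) (m : ℕ) :
    AnalyticOnNhd ℂ (interpField F m) (interpDomain D F m) := by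
  intro x hx
  refine Finset.analyticAt_fun_sum (f := fun (k : ℕ) x => ((-1 : ℂ) ^ (k - 1) / (k : ℂ)) • finDiff F k x)
    _ fun k hk => ?_
  exact analyticAt_const.fun_smul (analyticOnNhd_finDiff hF k x fun i hi =>
    hx i (hi.trans_le (Finset.mem_Icc.1 hk).2))

/-- Competing solutions may wander anywhere in `U`, so uniqueness rests on local Lipschitz
continuity of `X` on all of `U`, not on the small ball used for existence. -/
theorem exists_isFlowMap_of_isSolution {U S : Set (Fin d → ℂ)} {X F : (Fin d → ℂ) → (Fin d → ℂ)}
    {B : ℝ} (hB : 0 ≤ B) (hX : AnalyticOnNhd ℂ X U)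
    (h : ∀ x ∈ S, ∃ γ, IsSolution U X 1 x γ ∧ ‖γ 1 - F x‖ ≤ B) :
    ∃ Φ : (Fin d → ℂ) → (Fin d → ℂ), IsFlowMap U X 1 S Φ ∧
      supNorm S (fun x => Φ x - F x) ≤ ENNReal.ofReal B := by
  choose! γ hγ hγB using h
  refine ⟨fun x => γ x 1, fun x hx => ⟨⟨γ x, hγ x hx⟩, fun γ' hγ' => ?_⟩,
    (supNorm_le_ofReal_iff hB).2 hγB⟩
  exact IsIntegralCurveOn.eqOn_Icc_of_locallyLipschitzOn hX.locallyLipschitzOn hγ'.2.2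
    (hγ x hx).2.2 hγ'.2.1 (hγ x hx).2.1 (hγ'.1.trans (hγ x hx).1.symm) (by simp)

/-- The constant `c₀` is tuned for this: `m - 1 ≤ c₀ / α` and `6 c₀ = 1 / e`. The power `m` then
decays like `e ^ (-m)`. -/
theorem six_mul_le_exp_neg_one {α : ℝ} (hα : 0 < α) {m : ℕ} (hm : m ≤ optOrder α) :
    6 * ((m : ℝ) - 1) * α ≤ Real.exp (-1) := by
  have h0 : 0 ≤ c₀ / α := div_nonneg (by unfold c₀; positivity) hα.le
  have h1 : (m : ℝ) ≤ ⌊c₀ / α⌋₊ + 1 := by exact_mod_cast hm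
  have h2 : (m : ℝ) - 1 ≤ c₀ / α := by linarith [Nat.floor_le h0]
  rw [le_div_iff₀ hα] at h2
  have h3 : 6 * c₀ = Real.exp (-1) := by
    rw [c₀, Real.exp_neg]; field_simp
  linarith

theorem pow_optOrder_le {α : ℝ} (hα : 0 < α) :
    (6 * ((optOrder α : ℝ) - 1) * α) ^ optOrder α ≤ Real.exp (-(c₀ / α)) := by
  have h1 : (0 : ℝ) ≤ (optOrder α : ℝ) - 1 := by simp [optOrder]
  calc _ ≤ Real.exp (-1) ^ optOrder α := by
        gcongr; exact six_mul_le_exp_neg_one hα le_rfl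
    _ = Real.exp (-(optOrder α : ℝ)) := by rw [← Real.exp_nat_mul]; simp
    _ ≤ _ := by
        gcongr
        have := Nat.lt_floor_add_one (c₀ / α)
        simp only [optOrder]; push_cast; exact this.le

theorem two_le_optOrder {α : ℝ} (hα : 0 < α) (h : α ≤ c₀) : 2 ≤ optOrder α := by
  have : 1 ≤ ⌊c₀ / α⌋₊ := Nat.le_floor (by
    rw [Nat.cast_one, le_div_iff₀ hα, one_mul]; exact h)
  simp only [optOrder]; omega

/-! ### Specialisation to `F`, with `μ = ε`. -/

section Main

variable {D₀ : Set (Fin d → ℂ)} {ε δ : ℝ} {F : (Fin d → ℂ) → (Fin d → ℂ)}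

/-- The normalised displacement of `F`. -/
noncomputable def displacement (F : (Fin d → ℂ) → (Fin d → ℂ)) (ε : ℝ) (x : Fin d → ℂ) :
    Fin d → ℂ := (ε : ℂ)⁻¹ • (F x - x)

theorem stepMap_displacement (hε : 0 < ε) : stepMap (displacement F ε) (ε : ℂ) = F := by
  funext x
  rw [stepMap, displacement, smul_inv_smul₀ (by exact_mod_cast hε.ne')]
  abel

theorem InBall.norm_sub_le {D : Set (Fin d → ℂ)} (hF : InBall D ε F) (hε : 0 < ε)
    {x : Fin d → ℂ} (hx : x ∈ D) : ‖F x - x‖ ≤ ε := (supNorm_le_ofReal_iff hε.le).1 hF.2 x hx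

theorem InBall.norm_displacement_le {D : Set (Fin d → ℂ)} (hF : InBall D ε F) (hε : 0 < ε)
    {x : Fin d → ℂ} (hx : x ∈ D) : ‖displacement F ε x‖ ≤ 1 := by
  rw [displacement, norm_smul, norm_inv, Complex.norm_real, Real.norm_of_nonneg hε.le,
    ← div_eq_inv_mul, div_le_one hε]
  exact hF.norm_sub_le hε hx

theorem InBall.analyticOnNhd_displacement {D : Set (Fin d → ℂ)} (hF : InBall D ε F) :
    AnalyticOnNhd ℂ (displacement F ε) D := fun x hx =>
  analyticAt_const.fun_smul ((hF.1 x hx).fun_sub analyticAt_id)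

theorem thickening_subset_interpDomain (hε : 0 < ε) (hF : InBall (thickening δ D₀) ε F) {m : ℕ}
    (hmε : 6 * ((m : ℝ) - 1) * ε < δ) :
    thickening (δ / 3) D₀ ⊆ interpDomain (thickening δ D₀) F m := by
  intro x hx k hk
  obtain ⟨x₀, hx₀, hxx₀⟩ := mem_thickening_iff.1 hx
  rw [dist_eq_norm] at hxx₀
  have hkm : (k : ℝ) ≤ m - 1 := by
    have : (k : ℝ) + 1 ≤ m := by exact_mod_cast hk
    linarith
  have hkε : (k : ℝ) * ε ≤ (m - 1) * ε := by gcongr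
  have hδ : 0 < δ := by linarith [norm_nonneg (x - x₀)]
  have hsub := ball_subset_thickening hx₀ δ
  have hlt : ‖x - x₀‖ + k * ‖(ε : ℂ)‖ < δ := by
    rw [Complex.norm_real, Real.norm_of_nonneg hε.le]; linarith
  have := norm_stepMap_iterate_sub_le (fun y hy => hF.norm_displacement_le hε (hsub hy))
    (ε : ℂ) k hlt
  rw [stepMap_displacement hε] at this
  exact hsub (by rw [mem_ball, dist_eq_norm]; exact this.trans_lt hlt)

theorem exists_isSolution_interpField_one (hε : 0 < ε) (hεδ : ε < δ)
    (hF : InBall (thickening δ D₀) ε F) {x₀ : Fin d → ℂ} (hx₀ : x₀ ∈ D₀) :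
    ∃ γ, IsSolution (thickening δ D₀) (interpField F 1) 1 x₀ γ ∧
      ‖γ 1 - F x₀‖ ≤ 2 * ε ^ 2 / δ := by
  have hδ : 0 < δ := hε.trans hεδ
  have hsub := ball_subset_thickening hx₀ δ
  have hf : AnalyticOnNhd ℂ (displacement F ε) (ball x₀ δ) :=
    hF.analyticOnNhd_displacement.mono hsub
  have hb : ∀ x ∈ ball x₀ δ, ‖displacement F ε x‖ ≤ 1 :=
    fun y hy => hF.norm_displacement_le hε (hsub hy)
  have hnε : ‖(ε : ℂ)‖ = ε := by rw [Complex.norm_real, Real.norm_of_nonneg hε.le]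
  have hgeo : ∀ μ ∈ ball (0 : ℂ) δ, ∀ x ∈ ball x₀ δ, ∀ k : ℕ, k < 1 →
      ‖x - x₀‖ + k * ‖μ‖ < δ := by
    intro μ _ x hx k hk
    obtain rfl : k = 0 := by omega
    rw [mem_ball, dist_eq_norm] at hx
    simpa using hx
  -- For `m = 1` no iterate is needed, so the whole ball and the whole disk of radius `δ` are
  -- available: `2 δ (ε / δ)²` is the claimed bound.
  obtain ⟨γ, h0, hmem, hγ, hbd⟩ := exists_integralCurve_interpField (m := 1) (c := 1) (R := δ)
    (μ₀ := δ) hf hb le_rfl one_pos hδ (by linarith) hgeo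
    (fun μ hμ x hx => by
      refine (norm_interpField_le_sum _ 1 x).trans ?_
      simpa using (analyticAt_finDiff_stepMap hf hb 0 μ x (hgeo μ hμ x hx 0 one_pos)).2)
    (μ := (ε : ℂ)) (mem_ball_zero_iff.2 (by rwa [hnε]))
  rw [stepMap_displacement hε] at hγ hbd
  rw [hnε] at hbd hmem
  refine ⟨γ, ⟨h0, fun t _ => hsub (closedBall_subset_ball (by linarith) (hmem t)), hγ⟩,
    hbd.trans_eq ?_⟩
  rw [div_pow]
  field_simp
  ring

theorem InBall.norm_interpField_le (hε : 0 < ε) (hF : InBall (thickening δ D₀) ε F) {m : ℕ}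
    (hmε : 6 * ((m : ℝ) - 1) * ε < δ) {x : Fin d → ℂ} (hx : x ∈ thickening (δ / 3) D₀) :
    ‖interpField F m x‖ ≤ 2 * ε := by
  obtain ⟨x₀, hx₀, hxx₀⟩ := mem_thickening_iff.1 hx
  have hsub := ball_subset_thickening hx₀ δ
  have hnε : ‖(ε : ℂ)‖ = ε := by rw [Complex.norm_real, Real.norm_of_nonneg hε.le]
  have := norm_interpField_stepMap_le (hF.analyticOnNhd_displacement.mono hsub)
    (fun y hy => hF.norm_displacement_le hε (hsub hy)) (m := m) (μ := (ε : ℂ))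
    (by rw [hnε]; exact hmε.le) (dist_eq_norm x x₀ ▸ hxx₀)
  rwa [stepMap_displacement hε, hnε] at this

theorem exists_isSolution_interpField (hε : 0 < ε) (hδ : 0 < δ)
    (hF : InBall (thickening δ D₀) ε F) {m : ℕ} (hm : 2 ≤ m)
    (hmε : 6 * ((m : ℝ) - 1) * ε < δ) {x₀ : Fin d → ℂ} (hx₀ : x₀ ∈ D₀) :
    ∃ γ, IsSolution (interpDomain (thickening δ D₀) F m) (interpField F m) 1 x₀ γ ∧
      ‖γ 1 - F x₀‖ ≤ 3 * ε * (6 * ((m : ℝ) - 1) * ε / δ) ^ m := by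
  have hm1 : (1 : ℝ) ≤ m - 1 := by
    have : (2 : ℝ) ≤ m := by exact_mod_cast hm
    linarith
  have hsub := ball_subset_thickening hx₀ δ
  have hf : AnalyticOnNhd ℂ (displacement F ε) (ball x₀ δ) :=
    hF.analyticOnNhd_displacement.mono hsub
  have hb : ∀ x ∈ ball x₀ δ, ‖displacement F ε x‖ ≤ 1 :=
    fun y hy => hF.norm_displacement_le hε (hsub hy)
  have hnε : ‖(ε : ℂ)‖ = ε := by rw [Complex.norm_real, Real.norm_of_nonneg hε.le]
  -- The range of `μ` in which `X_m` is bounded by `2 |μ|`. As `m ≥ 2`, also `2 μ₀ ≤ δ / 3`, so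
  -- solutions stay where this bound holds.
  set μ₀ : ℝ := δ / (6 * ((m : ℝ) - 1)) with hμ₀def
  have hμ₀ : 0 < μ₀ := by positivity
  have hmμ₀ : 6 * ((m : ℝ) - 1) * μ₀ = δ := by rw [hμ₀def]; field_simp
  have hεμ₀ : ε < μ₀ := by rw [hμ₀def, lt_div_iff₀ (by positivity)]; linarith
  have h6 : 6 * μ₀ ≤ δ := by nlinarith
  have hlin : ∀ μ ∈ ball (0 : ℂ) μ₀, 6 * (((m : ℝ) - 1) * ‖μ‖) ≤ δ := fun μ hμ => by
    rw [← hmμ₀, mul_assoc]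
    gcongr
    exact (mem_ball_zero_iff.1 hμ).le
  have hgeo : ∀ μ ∈ ball (0 : ℂ) μ₀, ∀ x ∈ ball x₀ (δ / 3), ∀ k < m,
      ‖x - x₀‖ + k * ‖μ‖ < δ := by
    intro μ hμ x hx k hk
    rw [mem_ball, dist_eq_norm] at hx
    have hkm : (k : ℝ) ≤ m - 1 := by
      have : (k : ℝ) + 1 ≤ m := by exact_mod_cast hk
      linarith
    have : (k : ℝ) * ‖μ‖ ≤ (m - 1) * ‖μ‖ := by gcongr
    linarith [hlin μ hμ]
  obtain ⟨γ, h0, hmem, hγ, hbd⟩ := exists_integralCurve_interpField (m := m) (c := 2)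
    (R := δ / 3) (μ₀ := μ₀) hf hb (by omega) two_pos hμ₀ (by linarith) hgeo
    (fun μ hμ x hx => norm_interpField_stepMap_le hf hb (by linarith [hlin μ hμ])
      (by rwa [mem_ball, dist_eq_norm] at hx))
    (μ := (ε : ℂ)) (mem_ball_zero_iff.2 (by rwa [hnε]))
  rw [stepMap_displacement hε] at hγ hbd
  rw [hnε] at hbd hmem
  refine ⟨γ, ⟨h0, fun t _ => thickening_subset_interpDomain hε hF hmε
    (ball_subset_thickening hx₀ _ (closedBall_subset_ball (by linarith) (hmem t))), hγ⟩,
    hbd.trans_eq ?_⟩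
  have e : ε / μ₀ = 6 * ((m : ℝ) - 1) * ε / δ := by
    rw [hμ₀def]; field_simp
  rw [← e, pow_succ]
  field_simp
  norm_num

end Main

end DiscreteAveraging

theorem mainTheorem2 (d : ℕ) (D₀ : Set (Fin d → ℂ)) (ε δ : ℝ) (hε : 0 < ε) (hδ : 0 < δ)
    (hεδ : ε / δ ≤ DiscreteAveraging.c₀) (F : (Fin d → ℂ) → (Fin d → ℂ))
    (hF : DiscreteAveraging.InBall (Metric.thickening δ D₀) ε F) :
    -- order one
    (AnalyticOnNhd ℂ (DiscreteAveraging.interpField F 1) (Metric.thickening δ D₀) ∧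
      DiscreteAveraging.supNorm (Metric.thickening δ D₀) (DiscreteAveraging.interpField F 1)
        ≤ ENNReal.ofReal ε ∧
      ∃ Φ : (Fin d → ℂ) → (Fin d → ℂ),
        DiscreteAveraging.IsFlowMap (Metric.thickening δ D₀)
          (DiscreteAveraging.interpField F 1) 1 D₀ Φ ∧
        DiscreteAveraging.supNorm D₀ (fun x => Φ x - F x) ≤ ENNReal.ofReal (2 * ε ^ 2 / δ)) ∧
    -- orders between two and the optimal one
    (∀ m : ℕ, 2 ≤ m → m ≤ DiscreteAveraging.optOrder (ε / δ) →
      Metric.thickening (δ / 3) D₀ ⊆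
        DiscreteAveraging.interpDomain (Metric.thickening δ D₀) F m ∧
      AnalyticOnNhd ℂ (DiscreteAveraging.interpField F m) (Metric.thickening (δ / 3) D₀) ∧
      DiscreteAveraging.supNorm (Metric.thickening (δ / 3) D₀)
        (DiscreteAveraging.interpField F m) ≤ ENNReal.ofReal (2 * ε) ∧
      ∃ Φ : (Fin d → ℂ) → (Fin d → ℂ),
        DiscreteAveraging.IsFlowMap
          (DiscreteAveraging.interpDomain (Metric.thickening δ D₀) F m)
          (DiscreteAveraging.interpField F m) 1 D₀ Φ ∧
        DiscreteAveraging.supNorm D₀ (fun x => Φ x - F x) ≤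
          ENNReal.ofReal (3 * ε * (6 * ((m : ℝ) - 1) * ε / δ) ^ m)) ∧
    -- the optimal order
    (∃ Φ : (Fin d → ℂ) → (Fin d → ℂ),
      DiscreteAveraging.IsFlowMap
        (DiscreteAveraging.interpDomain (Metric.thickening δ D₀) F
          (DiscreteAveraging.optOrder (ε / δ)))
        (DiscreteAveraging.interpField F (DiscreteAveraging.optOrder (ε / δ))) 1 D₀ Φ ∧
      DiscreteAveraging.supNorm D₀ (fun x => Φ x - F x) ≤
        ENNReal.ofReal (3 * ε * Real.exp (-(DiscreteAveraging.c₀ * δ / ε)))) := by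
  have hα : 0 < ε / δ := div_pos hε hδ
  -- Strictness, from `1 / e < 1`, puts `ε` inside the open disk `|μ| < μ₀`.
  have hgap : ∀ m : ℕ, m ≤ DiscreteAveraging.optOrder (ε / δ) →
      6 * ((m : ℝ) - 1) * ε < δ := fun m hm => by
    have h1 := DiscreteAveraging.six_mul_le_exp_neg_one hα hm
    have h2 : Real.exp (-1) < 1 := by simp
    have h3 := h1.trans_lt h2
    rwa [← mul_div_assoc, div_lt_one hδ] at h3
  have h2M := DiscreteAveraging.two_le_optOrder hα hεδ
  have hlt : ε < δ := by
    have := hgap 2 h2M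
    norm_num at this
    linarith
  have hflow : ∀ m : ℕ, 2 ≤ m → m ≤ DiscreteAveraging.optOrder (ε / δ) →
      ∃ Φ : (Fin d → ℂ) → (Fin d → ℂ),
        DiscreteAveraging.IsFlowMap
          (DiscreteAveraging.interpDomain (Metric.thickening δ D₀) F m)
          (DiscreteAveraging.interpField F m) 1 D₀ Φ ∧
        DiscreteAveraging.supNorm D₀ (fun x => Φ x - F x) ≤
          ENNReal.ofReal (3 * ε * (6 * ((m : ℝ) - 1) * ε / δ) ^ m) := fun m hm hmM => by
    have hm1 : (0 : ℝ) ≤ m - 1 := by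
      have : (2 : ℝ) ≤ m := by exact_mod_cast hm
      linarith
    exact DiscreteAveraging.exists_isFlowMap_of_isSolution (by positivity)
      (DiscreteAveraging.analyticOnNhd_interpField hF.1 m)
      fun x hx => DiscreteAveraging.exists_isSolution_interpField hε hδ hF hm (hgap m hmM) hx
  have e1 : DiscreteAveraging.interpField F 1 = fun x => F x - x := by
    funext x
    simp [DiscreteAveraging.interpField, DiscreteAveraging.finDiff]
  have ha1 : AnalyticOnNhd ℂ (DiscreteAveraging.interpField F 1) (Metric.thickening δ D₀) := by
    rw [e1]
    exact hF.1.sub analyticOnNhd_id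
  refine ⟨⟨ha1, e1 ▸ hF.2, DiscreteAveraging.exists_isFlowMap_of_isSolution (by positivity) ha1
    fun x hx => DiscreteAveraging.exists_isSolution_interpField_one hε hlt hF hx⟩,
    fun m hm hmM => ?_, ?_⟩
  · have hsub := DiscreteAveraging.thickening_subset_interpDomain hε hF (hgap m hmM)
    exact ⟨hsub, (DiscreteAveraging.analyticOnNhd_interpField hF.1 m).mono hsub,
      (DiscreteAveraging.supNorm_le_ofReal_iff (by positivity)).2
        fun x hx => DiscreteAveraging.InBall.norm_interpField_le hε hF (hgap m hmM) hx,
      hflow m hm hmM⟩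
  · obtain ⟨Φ, hΦ, hbd⟩ := hflow _ h2M le_rfl
    refine ⟨Φ, hΦ, hbd.trans (ENNReal.ofReal_le_ofReal ?_)⟩
    have h := DiscreteAveraging.pow_optOrder_le hα
    rw [← mul_div_assoc, div_div_eq_mul_div] at h
    gcongr
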